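/- **Setting.** Let $G$ be a compact connected Lie group with Lie algebra $\mathfrak g$ and $H<G$ a closed connected Lie subgroup with Lie algebra $\mathfrak h\subset\mathfrak g$, such that $\dim G/H\ge 3$. Let $Q$ be an $\mathrm{Ad}(G)$-invariant scalar product on $\mathfrak g$ (equivalently, one induced by a bi-invariant Riemannian metric on $G$), and let $B$ be the Killing form of $\mathfrak g$. For subspaces $\mathfrak v\subset\mathfrak u$ of $\mathfrak g$, let $\mathfrak u\ominus\mathfrak v$ denote the $Q$-orthogonal complement of $\mathfrak v$ in $\mathfrak u$. Put $\mathfrak m=\mathfrak g\ominus\mathfrak h$ and let $T$ be an $\mathrm{Ad}(H)$-invariant scalar product on $\mathfrak m$ (i.e. a $G$-invariant Riemannian metric on $G/H$). For a Lie subalgebra $\mathfrak k$ of $\mathfrak g$ with $\mathfrak h\subsetneq\mathfrak k$, put $\mathfrak n=\mathfrak k\ominus\mathfrak h$ and $\mathfrak l=\mathfrak g\ominus\mathfrak k$. Let $\mathcal M_T(\mathfrak k)$ be the set of $\mathrm{Ad}(H)$-invariant scalar products $h$ on $\mathfrak n$ with $\mathrm{tr}_h\,T|_{\mathfrak n}=1$.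 For such $h$ put $$\hat S(h)=-\tfrac12\,\mathrm{tr}_h B|_{\mathfrak n}-\tfrac12\,|\Delta(\mathfrak l,\mathfrak n,\mathfrak l)|^2_{\mathrm{mix}}-\tfrac14\,|\Delta(\mathfrak n,\mathfrak n,\mathfrak n)|_h^2,$$ where $\Delta(\mathfrak u_1,\mathfrak u_2,\mathfrak u_3)\in\mathfrak u_1\otimes\mathfrak u_2^*\otimes\mathfrak u_3^*$ is the map $(X,Y)\mapsto\pi_{\mathfrak u_1}[X,Y]$ for $X\in\mathfrak u_2$, $Y\in\mathfrak u_3$ (with $\pi_{\mathfrak u_1}$ the $Q$-orthogonal projection onto $\mathfrak u_1$), $|\cdot|_{\mathrm{mix}}$ is the norm induced by $Q|_{\mathfrak l}$ and $h$ on $\mathfrak l\otimes\mathfrak n^*\otimes\mathfrak l^*$, and $|\cdot|_h$ is the norm induced by $h$ on $\mathfrak n\otimes\mathfrak n^*\otimes\mathfrak n^*$. Let $\sigma(\mathfrak k,T)=\sup\{\hat S(h)\mid h\in\mathcal M_T(\mathfrak k)\}$. A Lie subalgebra $\mathfrak k$ of $\mathfrak g$ with $\mathfrak h\subsetneq\mathfrak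 k$ is called *$T$-apical* if (1) $\mathfrak k\ne\mathfrak g$; (2) there is $h\in\mathcal M_T(\mathfrak k)$ with $\hat S(h)=\sigma(\mathfrak k,T)$; and (3) $\sigma(\mathfrak s,T)\le\sigma(\mathfrak k,T)$ for every maximal Lie subalgebra $\mathfrak s$ of $\mathfrak g$ containing $\mathfrak h$. **Theorem.** Assume that every Lie subalgebra $\mathfrak s$ of $\mathfrak g$ with $\mathfrak h\subset\mathfrak s$ satisfies the following requirement: if $\mathfrak u\subset\mathfrak s\ominus\mathfrak h$ and $\mathfrak v\subset\mathfrak g\ominus\mathfrak s$ are non-zero $\mathrm{Ad}(H)$-invariant subspaces, then the representations $\mathrm{Ad}(H)|_{\mathfrak u}$ and $\mathrm{Ad}(H)|_{\mathfrak v}$ are inequivalent. Suppose that $\mathfrak h$ is not a maximal Lie subalgebra of $\mathfrak g$. Then $\mathfrak g$ has at least one $T$-apical subalgebra. -/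

import Mathlib

open scoped Manifold ContDiff

noncomputable section

namespace HomSpace

/-! ### Scalar products, traces and orthogonal complements -/

/-- A scalar product (positive-definite symmetric bilinear form) on a real vector space. -/
structure ScalarProduct (V : Type*) [AddCommGroup V] [Module ℝ V] where
  form : LinearMap.BilinForm ℝ V
  symm : ∀ u v, form u v = form v u
  pos : ∀ v, v ≠ 0 → 0 < form v v

namespace ScalarProduct

variable {V : Type*} [AddCommGroup V] [Module ℝ V]

/-- The restriction of a scalar product to a subspace. -/
def restrict (X : ScalarProduct V) (W : Submodule ℝ V) : ScalarProduct W where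
  form := X.form.compl₁₂ W.subtype W.subtype
  symm u v := X.symm u v
  pos v hv := X.pos v (by simpa using hv)

theorem exists_orthonormal_basis [FiniteDimensional ℝ V] (X : ScalarProduct V) :
    ∃ b : Module.Basis (Fin (Module.finrank ℝ V)) ℝ V,
      ∀ i j, X.form (b i) (b j) = if i = j then 1 else 0 := by
  let core : InnerProductSpace.Core ℝ V :=
    { inner := fun x y => X.form x y
      conj_inner_symm := fun x y => by simpa using X.symm y x
      re_inner_nonneg := fun x => by
        by_cases h : x = 0
        · simp [h]
        · simpa using (X.pos x h).le
      add_left := fun x y z => by simp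
      smul_left := fun x y r => by simp
      definite := fun x hx => by
        by_contra h
        exact (X.pos x h).ne' hx }
  let _ : NormedAddCommGroup V := core.toNormedAddCommGroup
  let _ : InnerProductSpace ℝ V := InnerProductSpace.ofCore core.toCore
  refine ⟨(stdOrthonormalBasis ℝ V).toBasis, fun i j => ?_⟩
  have h := orthonormal_iff_ite.mp (stdOrthonormalBasis ℝ V).orthonormal i j
  rw [OrthonormalBasis.coe_toBasis]
  exact h

/-- A chosen orthonormal basis with respect to a scalar product. -/
def onb [FiniteDimensional ℝ V] (X : ScalarProduct V) :
    Module.Basis (Fin (Module.finrank ℝ V)) ℝ V :=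
  X.exists_orthonormal_basis.choose

theorem form_onb [FiniteDimensional ℝ V] (X : ScalarProduct V) (i j : Fin (Module.finrank ℝ V)) :
    X.form (X.onb i) (X.onb j) = if i = j then 1 else 0 :=
  X.exists_orthonormal_basis.choose_spec i j

/-- The trace with respect to `X` of a quadratic form `q`, i.e. the sum of the values of `q` over
an `X`-orthonormal basis (for a quadratic form this does not depend on the basis). -/
def tr [FiniteDimensional ℝ V] (X : ScalarProduct V) (q : V → ℝ) : ℝ :=
  ∑ i, q (X.onb i)

end ScalarProduct

variable {L : Type*} [LieRing L] [LieAlgebra ℝ L]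

/-- `ominus Q U W` is `U ⊖ W`: the `Q`-orthogonal complement of `W` in `U` (for `W ≤ U`). -/
def ominus (Q : ScalarProduct L) (U W : Submodule ℝ L) : Submodule ℝ L :=
  U ⊓ Q.form.orthogonal W

theorem ominus_le_ominus_top (Q : ScalarProduct L) (U W : Submodule ℝ L) :
    ominus Q U W ≤ ominus Q ⊤ W :=
  inf_le_inf_right _ le_top

/-- The tangent space `𝔪 = 𝔤 ⊖ 𝔥` of the homogeneous space at the base point. -/
abbrev mSpace (Q : ScalarProduct L) (𝔥 : LieSubalgebra ℝ L) : Submodule ℝ L :=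
  ominus Q ⊤ 𝔥.toSubmodule

/-- The space `𝔫 = 𝔨 ⊖ 𝔥`. -/
abbrev nSpace (Q : ScalarProduct L) (𝔥 𝔨 : LieSubalgebra ℝ L) : Submodule ℝ L :=
  ominus Q 𝔨.toSubmodule 𝔥.toSubmodule

/-- The space `𝔩 = 𝔤 ⊖ 𝔨`. -/
abbrev lSpace (Q : ScalarProduct L) (𝔨 : LieSubalgebra ℝ L) : Submodule ℝ L :=
  ominus Q ⊤ 𝔨.toSubmodule

/-! ### The extended scalar curvature functional -/

section Curvature

variable [FiniteDimensional ℝ L]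

/-- The `Q`-orthogonal projection of the whole Lie algebra onto the subspace `W`. -/
def proj (Q : ScalarProduct L) (W : Submodule ℝ L) (x : L) : W :=
  ∑ i, Q.form x ((Q.restrict W).onb i : L) • (Q.restrict W).onb i

/-- The squared norm of the tensor `Δ(𝔲₁, 𝔲₂, 𝔲₃) ∈ 𝔲₁ ⊗ 𝔲₂* ⊗ 𝔲₃*`, `(X, Y) ↦ π_{𝔲₁} [X, Y]`, with
respect to the scalar products `X₁`, `X₂`, `X₃` on the three factors. -/
def deltaNormSq (Q : ScalarProduct L) {U₁ U₂ U₃ : Submodule ℝ L} (X₁ : ScalarProduct U₁)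
    (X₂ : ScalarProduct U₂) (X₃ : ScalarProduct U₃) : ℝ :=
  X₂.tr fun x => X₃.tr fun y =>
    X₁.form (proj Q U₁ ⁅(x : L), (y : L)⁆) (proj Q U₁ ⁅(x : L), (y : L)⁆)

/-- The functional `Ŝ(h) = -½ tr_h B|_𝔫 - ½ |Δ(𝔩,𝔫,𝔩)|²_mix - ¼ |Δ(𝔫,𝔫,𝔫)|²_h` on scalar products
`h` on `𝔫 = 𝔨 ⊖ 𝔥`, where `B` is the Killing form and `𝔩 = 𝔤 ⊖ 𝔨`. -/
def hatS (Q : ScalarProduct L) (𝔥 𝔨 : LieSubalgebra ℝ L)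
    (h : ScalarProduct (nSpace Q 𝔥 𝔨)) : ℝ :=
  -(1 / 2) * h.tr (fun x => killingForm ℝ L (x : L) (x : L))
    - (1 / 2) * deltaNormSq Q (Q.restrict (lSpace Q 𝔨)) h (Q.restrict (lSpace Q 𝔨))
    - (1 / 4) * deltaNormSq Q h h h

end Curvature

/-! ### Invariance under the isotropy group -/

section Invariance

variable {S : Type*} (ρ : S → L →ₗ[ℝ] L)

/-- Invariance of a subspace under the maps `ρ x`. -/
def InvariantSubspace (W : Submodule ℝ L) : Prop :=
  ∀ x, ∀ v ∈ W, ρ x v ∈ W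

/-- Invariance under the maps `ρ x` of a scalar product on an invariant subspace `W`. -/
def InvariantForm {W : Submodule ℝ L} (h : ScalarProduct W) : Prop :=
  ∀ x, ∀ u v u' v' : W, ρ x u = u' → ρ x v = v' → h.form u' v' = h.form u v

/-- The restrictions of `ρ` to the invariant subspaces `U` and `V` are equivalent: there is a
linear isomorphism `φ : U → V` with `φ ∘ ρ x = ρ x ∘ φ` for all `x`. -/
def EquivalentReps (U V : Submodule ℝ L) : Prop :=
  ∃ φ : U ≃ₗ[ℝ] V, ∀ x, ∀ u u' : U, ρ x u = u' → ρ x (φ u) = φ u'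

/-- For every Lie subalgebra `𝔰 ⊇ 𝔥`, no non-zero invariant subspace of `𝔰 ⊖ 𝔥` is equivalent, as a
representation, to a non-zero invariant subspace of `𝔤 ⊖ 𝔰`. -/
def InequivalenceHypothesis (Q : ScalarProduct L) (𝔥 : LieSubalgebra ℝ L) : Prop :=
  ∀ 𝔰 : LieSubalgebra ℝ L, 𝔥 ≤ 𝔰 → ∀ U V : Submodule ℝ L,
    U ≤ nSpace Q 𝔥 𝔰 → V ≤ lSpace Q 𝔰 → U ≠ ⊥ → V ≠ ⊥ →
    InvariantSubspace ρ U → InvariantSubspace ρ V → ¬ EquivalentReps ρ U V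

end Invariance

/-! ### Apical subalgebras -/

section Apical

variable [FiniteDimensional ℝ L] {S : Type*} (ρ : S → L →ₗ[ℝ] L) (Q : ScalarProduct L)
  (𝔥 : LieSubalgebra ℝ L) (T : ScalarProduct (mSpace Q 𝔥))

/-- The space `𝓜_T(𝔨)` of invariant scalar products `h` on `𝔫 = 𝔨 ⊖ 𝔥` with `tr_h T|_𝔫 = 1`. -/
def MT (𝔨 : LieSubalgebra ℝ L) : Set (ScalarProduct (nSpace Q 𝔥 𝔨)) :=
  {h | InvariantForm ρ h ∧
    h.tr (fun x => T.form (Submodule.inclusion (ominus_le_ominus_top Q _ _) x)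
      (Submodule.inclusion (ominus_le_ominus_top Q _ _) x)) = 1}

/-- `σ(𝔨, T) = sup {Ŝ(h) | h ∈ 𝓜_T(𝔨)}`, taken in the extended reals so that no boundedness is
presupposed. -/
def sigma (𝔨 : LieSubalgebra ℝ L) : EReal :=
  ⨆ h ∈ MT ρ Q 𝔥 T 𝔨, (hatS Q 𝔥 𝔨 h : EReal)

/-- `𝔨` is a `T`-apical subalgebra: it is a Lie subalgebra with `𝔥 ⊊ 𝔨 ≠ 𝔤`, the supremum
`σ(𝔨, T)` is attained, and it is at least `σ(𝔰, T)` for each maximal Lie subalgebra `𝔰 ⊇ 𝔥`. -/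
structure IsApical (𝔨 : LieSubalgebra ℝ L) : Prop where
  lt : 𝔥 < 𝔨
  ne_top : 𝔨 ≠ ⊤
  attained : ∃ h ∈ MT ρ Q 𝔥 T 𝔨, (hatS Q 𝔥 𝔨 h : EReal) = sigma ρ Q 𝔥 T 𝔨
  sigma_le : ∀ 𝔰 : LieSubalgebra ℝ L, IsCoatom 𝔰 → 𝔥 ≤ 𝔰 → sigma ρ Q 𝔥 T 𝔰 ≤ sigma ρ Q 𝔥 T 𝔨

end Apical

/-! ### Lie groups -/

section Groups

variable {E : Type*} [NormedAddCommGroup E] [NormedSpace ℝ E]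
  {G : Type*} [TopologicalSpace G] [ChartedSpace E G] [Group G]

/-- A smooth real Lie group has the regularity under which the bracket on its Lie algebra is
defined. -/
instance instLieGroupMinSmoothness [LieGroup 𝓘(ℝ, E) ∞ G] :
    LieGroup 𝓘(ℝ, E) (minSmoothness ℝ 3) G :=
  LieGroup.of_le (n := ∞) (by
    rw [minSmoothness_of_isRCLikeNormedField]
    exact ENat.LEInfty.out)

instance [FiniteDimensional ℝ E] : FiniteDimensional ℝ (GroupLieAlgebra 𝓘(ℝ, E) G) :=
  inferInstanceAs (FiniteDimensional ℝ E)

variable (E) in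
/-- The adjoint representation: `Ad x` is the differential at the identity of `y ↦ x y x⁻¹`. -/
def Ad (x : G) : GroupLieAlgebra 𝓘(ℝ, E) G →ₗ[ℝ] GroupLieAlgebra 𝓘(ℝ, E) G :=
  (show E →L[ℝ] E from mfderiv 𝓘(ℝ, E) 𝓘(ℝ, E) (fun y : G => x * y * x⁻¹) 1).toLinearMap

variable {F : Type*} [NormedAddCommGroup F] [NormedSpace ℝ F]

variable (E F) in
/-- The differential at the identity of the inclusion of a Lie subgroup. -/
def inclusionDeriv (H : Subgroup G) [ChartedSpace F H] :
    GroupLieAlgebra 𝓘(ℝ, F) H →ₗ[ℝ] GroupLieAlgebra 𝓘(ℝ, E) G :=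
  (show F →L[ℝ] E from
    mfderiv 𝓘(ℝ, F) 𝓘(ℝ, E) (Subtype.val : H → G) (1 : H)).toLinearMap

/-- `𝔥` is the Lie algebra of the Lie subgroup `H`, viewed inside the Lie algebra of `G`: as a
subspace, it is the tangent space of `H` at the identity. -/
def IsLieAlgebraOf [LieGroup 𝓘(ℝ, E) ∞ G] [CompleteSpace E]
    (H : Subgroup G) [ChartedSpace F H]
    (𝔥 : LieSubalgebra ℝ (GroupLieAlgebra 𝓘(ℝ, E) G)) : Prop :=
  𝔥.toSubmodule = LinearMap.range (inclusionDeriv E F H)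

end Groups

end HomSpace

end

/-! The supremum of `Ŝ(h)` over *all* pairs `(𝔨, h)` with `𝔥 ⊊ 𝔨 ⊊ 𝔤` and `h ∈ 𝓜_T(𝔨)` is
attained, and the subalgebra `𝔨` of a maximizing pair is `T`-apical (`exists_isApical`): it attains
its own `σ(𝔨, T)` and dominates that of every other proper subalgebra, hence of the maximal ones.

Attainment is a compactness argument. A pair `(𝔨, h)` is encoded by a `Q`-orthonormal basis `f` of
`𝔤` adapted to `𝔤 = 𝔥 ⊕ 𝔫 ⊕ 𝔩` in which `h` is diagonal with entries `1 / μ a` (`IsFrame`,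
`exists_isFrame`, `IsFrame.hatS_eq`). With `[abc] = Q([f a, f b], f c)`,

`Ŝ(h) = -½ ∑_𝔫 μ a B(f a, f a) - ½ ∑_{a ∈ 𝔫; b, c ∈ 𝔩} μ a [abc]² - ¼ ∑_{𝔫} (μ a μ b / μ c) [abc]²`.

The bases are bounded, and so are the weights since `∑ μ a T(f a, f a) = 1`; so a maximizing
sequence converges, but some weights may tend to zero. The vectors of `𝔫` whose limit weight
is positive span a subspace `𝔫'`. It is invariant under the isotropy group, and boundedness of the
last sum gives `[𝔫', 𝔫'] ⊂ 𝔥 + 𝔫'`, so `𝔨' = 𝔥 + 𝔫'` is a subalgebra; it is proper and larger than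
`𝔥`, and the limit weights define `h' ∈ 𝓜_T(𝔨')`. No value is lost in the limit: passing from `𝔩` to
`𝔩' = 𝔤 ⊖ 𝔨'` enlarges the second sum by `½ ∑ μ a [abc]²` with `a ∈ 𝔫'` and `b, c ∈ 𝔫 ⊖ 𝔫'`, and
the third sum already contained at least as much, because `[abc]² = [bac]² = [acb]²` and
`μ b / μ c + μ c / μ b ≥ 2` (`sum_div_ge`, `exists_limit_frame`).

The algebraic input from the groups is that `Q` is `ad`-invariant (`form_lie_left`), that
`Ad(H)`-invariant subspaces are `ad(𝔥)`-invariant (`lie_mem_of_invariantSubspace`), and that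
subalgebras containing `𝔥` are `Ad(H)`-invariant (`invariantSubspace_of_le`). All three rest on
the derivative of `Ad` at the identity being the Lie bracket (`hasFDerivAt_Ad_chart`), which is
obtained by differentiating `x y = (x y x⁻¹) x` in a chart. -/

noncomputable section

namespace HomSpace

open Filter Topology

/-! ### The derivative of the adjoint representation in local coordinates -/

section Calculus
variable {E : Type*} [NormedAddCommGroup E] [NormedSpace ℝ E] [CompleteSpace E]

/-- Let `m` be a product with unit `a` and let `D₂ m (p, a) = D₁ m (a, p) ∘ C p` near `a`. By the
symmetry of the second derivative of `m`, the derivative of `C` at `a` is the antisymmetrization of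
the mixed second derivative of `m`. -/
theorem hasFDerivAt_of_comp_eq {m : E × E → E} {a : E} (hm : ContDiffAt ℝ 2 m (a, a))
    (hr : ∀ᶠ p in 𝓝 a, m (p, a) = p)
    {C : E → E →L[ℝ] E}
    (hC : ∀ᶠ p in 𝓝 a, (fderiv ℝ m (p, a)).comp (ContinuousLinearMap.inr ℝ E E)
      = ((fderiv ℝ m (a, p)).comp (ContinuousLinearMap.inl ℝ E E)).comp (C p))
    (hC1 : C a = ContinuousLinearMap.id ℝ E) (v : E) :
    ∃ D : E →L[ℝ] E, HasFDerivAt (fun p => C p v) D a ∧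
      ∀ u, D u = fderiv ℝ (fun p => fderiv ℝ m (p, a) (0, v)) a u
        - fderiv ℝ (fun p => fderiv ℝ m (p, a) (0, u)) a v := by
  have hd : DifferentiableAt ℝ (fderiv ℝ m) (a, a) :=
    (hm.fderiv_right (m := 1) (by norm_num)).differentiableAt (by norm_num)
  have hsymm : IsSymmSndFDerivAt ℝ m (a, a) := hm.isSymmSndFDerivAt (by simp)
  set D2 := fderiv ℝ (fderiv ℝ m) (a, a) with hD2
  have hA : HasFDerivAt (fun p => fderiv ℝ m (p, a))
      (D2.comp (ContinuousLinearMap.inl ℝ E E)) a :=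
    HasFDerivAt.comp a (f := fun p : E => (p, a)) hd.hasFDerivAt (hasFDerivAt_prodMk_left a a)
  have hB : HasFDerivAt (fun p => fderiv ℝ m (a, p))
      (D2.comp (ContinuousLinearMap.inr ℝ E E)) a :=
    HasFDerivAt.comp a (f := fun p : E => (a, p)) hd.hasFDerivAt (hasFDerivAt_prodMk_right a a)
  have hAv : ∀ w, HasFDerivAt (fun p => fderiv ℝ m (p, a) (0, w))
      ((D2.comp (ContinuousLinearMap.inl ℝ E E)).flip (0, w)) a := fun w => by
    simpa using! hA.clm_apply (hasFDerivAt_const ((0 : E), w) a)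
  set B : E → E →L[ℝ] E := fun p => (fderiv ℝ m (a, p)).comp (ContinuousLinearMap.inl ℝ E E) with hBdef
  have hBd : HasFDerivAt B _ a := hB.clm_comp (hasFDerivAt_const _ _)
  have hBa : B a = ContinuousLinearMap.id ℝ E := by
    have h1 : HasFDerivAt (fun p => m (p, a)) (B a) a :=
      HasFDerivAt.comp a (f := fun p : E => (p, a))
        (hm.differentiableAt (by norm_num)).hasFDerivAt (hasFDerivAt_prodMk_left a a)
    have h2 : HasFDerivAt (fun p => m (p, a)) (ContinuousLinearMap.id ℝ E) a :=
      (hasFDerivAt_id a).congr_of_eventuallyEq (by filter_upwards [hr] with p hp using hp)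
    exact h1.unique h2
  -- near `a` the operator `B p` is invertible, so `C p v` is smooth as `(B p)⁻¹ (D₂ m (p, a) v)`
  have hCd : DifferentiableAt ℝ (fun p => C p v) a := by
    have h1 : DifferentiableAt ℝ (fun p => (B p).inverse (fderiv ℝ m (p, a) (0, v))) a := by
      have h2 : DifferentiableAt ℝ (ContinuousLinearMap.inverse : (E →L[ℝ] E) → (E →L[ℝ] E)) (B a) := by
        have := contDiffAt_map_inverse (𝕜 := ℝ) (n := 1) (ContinuousLinearEquiv.refl ℝ E)
        rw [hBa]
        exact this.differentiableAt (by norm_num)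
      have h3 : DifferentiableAt ℝ (fun p => (B p).inverse) a :=
        DifferentiableAt.comp a h2 hBd.differentiableAt
      exact h3.clm_apply (hAv v).differentiableAt
    refine h1.congr_of_eventuallyEq ?_
    have hinv : ∀ᶠ p in 𝓝 a, B p ∈ Set.range ((↑) : (E ≃L[ℝ] E) → (E →L[ℝ] E)) := by
      apply hBd.continuousAt.eventually
      have := ContinuousLinearEquiv.nhds (ContinuousLinearEquiv.refl ℝ E)
      rw [hBa]
      exact this
    filter_upwards [hC, hinv] with p hp ⟨e, he⟩
    have : fderiv ℝ m (p, a) (0, v) = B p (C p v) := by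
      simpa [hBdef] using congrArg (fun l : E →L[ℝ] E => l v) hp
    rw [this, ← he]
    simp
  refine ⟨_, hCd.hasFDerivAt, fun u => ?_⟩
  have h1 := hBd.clm_apply hCd.hasFDerivAt
  have h2 : (fun p => B p (C p v)) =ᶠ[𝓝 a] fun p => fderiv ℝ m (p, a) (0, v) := by
    filter_upwards [hC] with p hp
    simpa [hBdef] using (congrArg (fun l : E →L[ℝ] E => l v) hp).symm
  have h3 := (h1.congr_of_eventuallyEq h2.symm).unique (hAv v)
  have h4 := congrArg (fun l : E →L[ℝ] E => l u) h3
  have h5 := hsymm.eq (0, u) (v, 0)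
  rw [(hAv v).fderiv, (hAv u).fderiv]
  simp [hBa, hC1] at h4 ⊢
  rw [← h4]
  rw [← hD2] at h5
  rw [h5]
  abel
end Calculus

section AdDeriv
variable {E : Type*} [NormedAddCommGroup E] [NormedSpace ℝ E]
  {G : Type*} [TopologicalSpace G] [ChartedSpace E G] [Group G]

variable (E G) in
/-- The preferred chart of `G` at the identity. -/
def chartOne : PartialEquiv G E := extChartAt 𝓘(ℝ, E) (1 : G)

theorem chartOne_symm_one : (chartOne E G).symm (chartOne E G 1) = 1 :=
  extChartAt_to_inv (I := 𝓘(ℝ, E)) (1 : G)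

variable (E G) in
/-- The multiplication of `G` read in the preferred chart at the identity. -/
def mulInChart (z : E × E) : E :=
  chartOne E G ((chartOne E G).symm z.1 * (chartOne E G).symm z.2)

variable (E) in
/-- The adjoint representation, with values in the continuous endomorphisms of the model space. -/
def AdCLM (x : G) : E →L[ℝ] E :=
  mfderiv 𝓘(ℝ, E) 𝓘(ℝ, E) (fun y : G => x * y * x⁻¹) 1

theorem tendsto_chartOne_symm :
    Tendsto (chartOne E G).symm (𝓝 (chartOne E G 1)) (𝓝 1) := by
  simpa using! (continuousAt_extChartAt_symm (I := 𝓘(ℝ, E)) (1 : G)).tendsto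

theorem mulInChart_right {p : E} (hp : p ∈ (chartOne E G).target) :
    mulInChart E G (p, chartOne E G 1) = p := by
  simp [mulInChart, chartOne_symm_one, (chartOne E G).right_inv hp]

theorem mulInChart_left {p : E} (hp : p ∈ (chartOne E G).target) :
    mulInChart E G (chartOne E G 1, p) = p := by
  simp [mulInChart, chartOne_symm_one, (chartOne E G).right_inv hp]

theorem eventually_mem_chart :
    ∀ᶠ p in 𝓝 (chartOne E G 1), p ∈ (chartOne E G).target :=
  extChartAt_target_mem_nhds (I := 𝓘(ℝ, E)) (1 : G)

variable [LieGroup 𝓘(ℝ, E) ∞ G]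

theorem mdifferentiable_conj (x : G) :
    MDifferentiable 𝓘(ℝ, E) 𝓘(ℝ, E) (fun y : G => x * y * x⁻¹) :=
  (((contMDiff_mul_right (I := 𝓘(ℝ, E)) (n := ∞) (a := x⁻¹)).comp
    (contMDiff_mul_left (I := 𝓘(ℝ, E)) (n := ∞) (a := x)))).mdifferentiable (by simp)

/-- In the chart at the identity, `Ad x` is the derivative of conjugation by `x`. -/
theorem hasFDerivAt_conj_chart (x : G) :
    HasFDerivAt (fun p : E => chartOne E G (x * (chartOne E G).symm p * x⁻¹))
      (AdCLM E x) (chartOne E G 1) := by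
  have h := ((mdifferentiable_conj (E := E) x) 1).hasMFDerivAt.2
  simp only [writtenInExtChartAt, mul_one, mul_inv_cancel, modelWithCornersSelf_coe, Set.range_id,
    ] at h
  exact hasFDerivWithinAt_univ.1 h

theorem AdCLM_one : AdCLM E (1 : G) = ContinuousLinearMap.id ℝ E := by
  refine (hasFDerivAt_conj_chart (E := E) (1 : G)).unique ?_
  refine (hasFDerivAt_id _).congr_of_eventuallyEq ?_
  filter_upwards [extChartAt_target_mem_nhds (I := 𝓘(ℝ, E)) (1 : G)] with p hp
  simp [(chartOne E G).right_inv hp]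

theorem eventually_conj_mem (x : G) :
    ∀ᶠ p in 𝓝 (chartOne E G 1), x * (chartOne E G).symm p * x⁻¹ ∈ (chartOne E G).source := by
  have h1 : Tendsto (fun y : G => x * y * x⁻¹) (𝓝 1) (𝓝 1) := by
    have := (mdifferentiable_conj (E := E) x).continuous.tendsto 1
    simpa using this
  exact (h1.comp tendsto_chartOne_symm).eventually (extChartAt_source_mem_nhds (I := 𝓘(ℝ, E)) (1 : G))

theorem AdCLM_mul (x y : G) : AdCLM E (x * y) = (AdCLM E x).comp (AdCLM E y) := by
  refine (hasFDerivAt_conj_chart (E := E) (x * y)).unique ?_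
  have hy := hasFDerivAt_conj_chart (E := E) y
  have hx : HasFDerivAt (fun p : E => chartOne E G (x * (chartOne E G).symm p * x⁻¹))
      (AdCLM E x) (chartOne E G (y * (chartOne E G).symm (chartOne E G 1) * y⁻¹)) := by
    simpa [chartOne_symm_one] using hasFDerivAt_conj_chart (E := E) x
  refine (HasFDerivAt.comp (chartOne E G 1) hx hy).congr_of_eventuallyEq ?_
  filter_upwards [eventually_conj_mem (E := E) y] with p hp
  simp only [Function.comp_def]
  rw [(chartOne E G).left_inv hp]
  congr 1
  group

theorem contDiffAt_mulInChart :
    ContDiffAt ℝ ∞ (mulInChart E G) (chartOne E G 1, chartOne E G 1) := by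
  have hs : ContMDiffAt 𝓘(ℝ, E) 𝓘(ℝ, E) ∞ (chartOne E G).symm (chartOne E G 1) := by
    have : IsManifold 𝓘(ℝ, E) ∞ G := (inferInstance : ContMDiffMul 𝓘(ℝ, E) ∞ G).toIsManifold
    have := contMDiffWithinAt_extChartAt_symm_range (I := 𝓘(ℝ, E)) (n := ∞) (1 : G)
      (mem_extChartAt_target (I := 𝓘(ℝ, E)) (1 : G))
    rwa [modelWithCornersSelf_coe, Set.range_id, contMDiffWithinAt_univ] at this
  have hc : ContMDiffAt 𝓘(ℝ, E) 𝓘(ℝ, E) ∞ (chartOne E G) (1 : G) := contMDiffAt_extChartAt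
  rw [← contMDiffAt_iff_contDiffAt]
  have h1 : ContMDiffAt 𝓘(ℝ, E × E) 𝓘(ℝ, E) ∞ (fun z : E × E => (chartOne E G).symm z.1)
      (chartOne E G 1, chartOne E G 1) :=
    ContMDiffAt.comp (x := (chartOne E G 1, chartOne E G 1)) (f := Prod.fst) hs contDiffAt_fst.contMDiffAt
  have h2 : ContMDiffAt 𝓘(ℝ, E × E) 𝓘(ℝ, E) ∞ (fun z : E × E => (chartOne E G).symm z.2)
      (chartOne E G 1, chartOne E G 1) :=
    ContMDiffAt.comp (x := (chartOne E G 1, chartOne E G 1)) (f := Prod.snd) hs contDiffAt_snd.contMDiffAt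
  have h3 := h1.mul h2
  refine ContMDiffAt.comp (x := (chartOne E G 1, chartOne E G 1)) (g := chartOne E G) ?_ h3
  simpa [chartOne_symm_one] using hc

theorem eventually_differentiableAt_mulInChart :
    ∀ᶠ p in 𝓝 (chartOne E G 1), DifferentiableAt ℝ (mulInChart E G) (p, chartOne E G 1) ∧
      DifferentiableAt ℝ (mulInChart E G) (chartOne E G 1, p) := by
  have h := ((contDiffAt_mulInChart (E := E) (G := G)).of_le (m := 1) (by norm_cast)).eventually (by simp)
  have h1 : Tendsto (fun p : E => (p, chartOne E G 1)) (𝓝 (chartOne E G 1))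
    (𝓝 (chartOne E G 1, chartOne E G 1)) := (by fun_prop : Continuous fun p : E => (p, chartOne E G 1)).tendsto _
  have h2 : Tendsto (fun p : E => (chartOne E G 1, p)) (𝓝 (chartOne E G 1))
    (𝓝 (chartOne E G 1, chartOne E G 1)) := (by fun_prop : Continuous fun p : E => (chartOne E G 1, p)).tendsto _
  filter_upwards [h1.eventually h, h2.eventually h] with p hp hq
  exact ⟨hp.differentiableAt (by norm_num), hq.differentiableAt (by norm_num)⟩

/-- Differentiating `x y = (x y x⁻¹) x` in `y` at the identity. -/
theorem eventually_fderiv_mulInChart :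
    ∀ᶠ p in 𝓝 (chartOne E G 1),
      (fderiv ℝ (mulInChart E G) (p, chartOne E G 1)).comp (ContinuousLinearMap.inr ℝ E E)
      = ((fderiv ℝ (mulInChart E G) (chartOne E G 1, p)).comp (ContinuousLinearMap.inl ℝ E E)).comp
        (AdCLM E ((chartOne E G).symm p)) := by
  filter_upwards [eventually_differentiableAt_mulInChart] with p hp
  set x := (chartOne E G).symm p with hx
  have h1 : HasFDerivAt (fun q => mulInChart E G (p, q)) _ (chartOne E G 1) :=
    HasFDerivAt.comp (chartOne E G 1) (f := fun q : E => (p, q)) hp.1.hasFDerivAt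
      (hasFDerivAt_prodMk_right p _)
  have h2 : HasFDerivAt (fun q => mulInChart E G (q, p)) _ (chartOne E G 1) :=
    HasFDerivAt.comp (chartOne E G 1) (f := fun q : E => (q, p)) hp.2.hasFDerivAt
      (hasFDerivAt_prodMk_left _ p)
  have hc := hasFDerivAt_conj_chart (E := E) x
  have hb : chartOne E G (x * (chartOne E G).symm (chartOne E G 1) * x⁻¹) = chartOne E G 1 := by
    simp [chartOne_symm_one]
  have h2' := h2
  rw [← hb] at h2'
  have h3 : HasFDerivAt (fun q => mulInChart E G (chartOne E G (x * (chartOne E G).symm q * x⁻¹), p))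
      _ (chartOne E G 1) :=
    HasFDerivAt.comp (chartOne E G 1) (g := fun q => mulInChart E G (q, p)) h2' hc
  rw [hb] at h3
  refine h1.unique (h3.congr_of_eventuallyEq ?_)
  filter_upwards [eventually_conj_mem (E := E) x] with q hq
  simp only [mulInChart]
  rw [(chartOne E G).left_inv hq, ← hx]
  congr 1
  group

/-- In the chart at the identity, left-invariant vector fields are given by the derivative of the
product in its second argument. -/
theorem eventually_mulInvariantVectorField_chart (v : E) :
    VectorField.mpullbackWithin 𝓘(ℝ, E) 𝓘(ℝ, E) (extChartAt 𝓘(ℝ, E) (1 : G)).symm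
        (mulInvariantVectorField (I := 𝓘(ℝ, E)) (G := G) v) (Set.range 𝓘(ℝ, E)) =ᶠ[𝓝 (chartOne E G 1)]
      fun p => fderiv ℝ (mulInChart E G) (p, chartOne E G 1) (0, v) := by
  have : IsManifold 𝓘(ℝ, E) ∞ G := (inferInstance : ContMDiffMul 𝓘(ℝ, E) ∞ G).toIsManifold
  have : IsManifold 𝓘(ℝ, E) 1 G := .of_le (n := ∞) (by norm_cast)
  filter_upwards [eventually_differentiableAt_mulInChart, eventually_mem_chart] with p hp hpt
  have hpt' : p ∈ (extChartAt 𝓘(ℝ, E) (1 : G)).target := hpt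
  rw [VectorField.mpullbackWithin_apply]
  rw [ContinuousLinearMap.inverse_eq
    (mfderivWithin_extChartAt_symm_comp_mfderiv_extChartAt hpt')
    (mfderiv_extChartAt_comp_mfderivWithin_extChartAt_symm hpt')]
  set x := (extChartAt 𝓘(ℝ, E) (1 : G)).symm p with hx
  have hxs : x * 1 ∈ (chartAt E (1 : G)).source := by
    rw [mul_one, ← extChartAt_source 𝓘(ℝ, E)]
    exact (extChartAt 𝓘(ℝ, E) (1 : G)).map_target hpt'
  have hd1 : MDifferentiableAt 𝓘(ℝ, E) 𝓘(ℝ, E) (extChartAt 𝓘(ℝ, E) (1 : G)) (x * 1) :=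
    mdifferentiableAt_extChartAt hxs
  have hd2 : MDifferentiableAt 𝓘(ℝ, E) 𝓘(ℝ, E) (fun y : G => x * y) 1 :=
    (contMDiff_mul_left (I := 𝓘(ℝ, E)) (n := ∞) (a := x)).mdifferentiable (by simp) 1
  have hcomp := mfderiv_comp (1 : G) hd1 hd2
  have h3 := (hd1.comp (1 : G) hd2).hasMFDerivAt.2
  rw [hcomp] at h3
  simp only [writtenInExtChartAt, modelWithCornersSelf_coe, Set.range_id] at h3
  have h4 : HasFDerivAt (fun q => mulInChart E G (p, q))
      (show E →L[ℝ] E from (mfderiv 𝓘(ℝ, E) 𝓘(ℝ, E) (extChartAt 𝓘(ℝ, E) (1 : G)) (x * 1)).comp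
        (mfderiv 𝓘(ℝ, E) 𝓘(ℝ, E) (fun y : G => x * y) 1)) (chartOne E G 1) :=
    hasFDerivWithinAt_univ.1 h3
  have h1 : HasFDerivAt (fun q => mulInChart E G (p, q)) _ (chartOne E G 1) :=
    HasFDerivAt.comp (chartOne E G 1) (f := fun q : E => (p, q)) hp.1.hasFDerivAt
      (hasFDerivAt_prodMk_right p _)
  have h5 := congrArg (fun l : E →L[ℝ] E => l v) (h4.unique h1)
  have key : ∀ z : G, z = x → ∀ w : E,
      (show E →L[ℝ] E from mfderiv 𝓘(ℝ, E) 𝓘(ℝ, E) (extChartAt 𝓘(ℝ, E) (1 : G)) z) w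
        = (show E →L[ℝ] E from mfderiv 𝓘(ℝ, E) 𝓘(ℝ, E) (extChartAt 𝓘(ℝ, E) (1 : G)) x) w := by
    rintro z rfl w
    rfl
  refine Eq.trans ?_ (h5.trans (by simp))
  exact (key (x * 1) (mul_one x) _).symm

/-- The derivative of the adjoint representation at the identity is the Lie bracket. -/
theorem hasFDerivAt_Ad_chart [CompleteSpace E] (v : E) :
    ∃ D : E →L[ℝ] E,
      HasFDerivAt (fun p => AdCLM E ((chartOne E G).symm p) v) D (chartOne E G 1) ∧
      ∀ u : E, D u = Bracket.bracket (L := GroupLieAlgebra 𝓘(ℝ, E) G)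
        (M := GroupLieAlgebra 𝓘(ℝ, E) G) u v := by
  obtain ⟨D, hD, hDu⟩ := hasFDerivAt_of_comp_eq (m := mulInChart E G)
    ((contDiffAt_mulInChart (E := E) (G := G)).of_le (by norm_cast))
    (by filter_upwards [eventually_mem_chart] with p hp using mulInChart_right hp)
    (C := fun p => AdCLM E ((chartOne E G).symm p)) eventually_fderiv_mulInChart
    (by rw [chartOne_symm_one, AdCLM_one]) v
  refine ⟨D, hD, fun u => ?_⟩
  refine (hDu u).trans ?_
  have h := GroupLieAlgebra.bracket_def (I := 𝓘(ℝ, E)) (G := G) u v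
  rw [← VectorField.mlieBracketWithin_univ, VectorField.mlieBracketWithin_apply] at h
  have hid : (show E →L[ℝ] E from mfderiv 𝓘(ℝ, E) 𝓘(ℝ, E) (extChartAt 𝓘(ℝ, E) (1 : G)) 1)
      = ContinuousLinearMap.id ℝ E := by
    have h3 := (mdifferentiableAt_extChartAt (I := 𝓘(ℝ, E)) (mem_chart_source E (1 : G))).hasMFDerivAt.2
    simp only [writtenInExtChartAt, modelWithCornersSelf_coe, Set.range_id] at h3
    refine HasFDerivAt.unique (hasFDerivWithinAt_univ.1 h3) ?_
    refine (hasFDerivAt_id _).congr_of_eventuallyEq ?_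
    filter_upwards [eventually_mem_chart (E := E) (G := G)] with p hp
    exact (chartOne E G).right_inv hp
  have hfix : ∀ w : E,
      fderiv ℝ (mulInChart E G) (chartOne E G 1, chartOne E G 1) (0, w) = w := fun w => by
    have h1 : HasFDerivAt (fun q => mulInChart E G (chartOne E G 1, q)) _ (chartOne E G 1) :=
      HasFDerivAt.comp (chartOne E G 1) (f := fun q : E => (chartOne E G 1, q))
        ((contDiffAt_mulInChart (E := E) (G := G)).differentiableAt (by simp)).hasFDerivAt
        (hasFDerivAt_prodMk_right _ _)
    have h2 : HasFDerivAt (fun q => mulInChart E G (chartOne E G 1, q))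
        (ContinuousLinearMap.id ℝ E) (chartOne E G 1) := by
      refine (hasFDerivAt_id _).congr_of_eventuallyEq ?_
      filter_upwards [eventually_mem_chart (E := E) (G := G)] with p hp
      exact mulInChart_left hp
    simpa using congrArg (fun l : E →L[ℝ] E => l w) (h1.unique h2)
  have hu := eventually_mulInvariantVectorField_chart (E := E) (G := G) u
  have hv := eventually_mulInvariantVectorField_chart (E := E) (G := G) v
  refine Eq.trans ?_ h.symm
  refine Eq.trans ?_ (congrArg (fun l : E →L[ℝ] E => l.inverse _) hid).symm
  rw [ContinuousLinearMap.inverse_id]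
  simp only [modelWithCornersSelf_coe, Set.range_id, Set.preimage_univ, Set.inter_univ] at hu hv ⊢
  refine Eq.trans (b := VectorField.lieBracketWithin (E := E) ℝ _ _ Set.univ (chartOne E G 1))
    ?_ rfl
  refine Eq.trans ?_ (congrFun VectorField.lieBracketWithin_univ (chartOne E G 1)).symm
  refine Eq.trans ?_ (congrFun (VectorField.lieBracket_eq (𝕜 := ℝ)) (chartOne E G 1)).symm
  have e1 := hu.fderiv_eq (𝕜 := ℝ)
  have e2 := hv.fderiv_eq (𝕜 := ℝ)
  have e3 := hu.eq_of_nhds.trans (hfix u)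
  have e4 := hv.eq_of_nhds.trans (hfix v)
  exact (congrArg₂ (fun x y : E => x - y)
    ((congrArg (fun l : E →L[ℝ] E => l u) e2).symm.trans (congrArg _ e3.symm))
    ((congrArg (fun l : E →L[ℝ] E => l v) e1).symm.trans (congrArg _ e4.symm)))

end AdDeriv

/-! ### Infinitesimal and global invariance -/

section OrthogonalProjection
variable {V : Type*} [AddCommGroup V] [Module ℝ V]

theorem ScalarProduct.eq_of_forall_form_eq (X : ScalarProduct V) {x y : V}
    (h : ∀ w, X.form x w = X.form y w) : x = y := by
  by_contra hne
  have h1 := X.pos (x - y) (sub_ne_zero.2 hne)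
  rw [map_sub X.form, LinearMap.sub_apply, h, sub_self] at h1
  exact h1.false

variable [FiniteDimensional ℝ V]

/-- The orthogonal projection onto a subspace `W`, as an endomorphism of the ambient space. -/
def ScalarProduct.orthProj (X : ScalarProduct V) (W : Submodule ℝ V) : V →ₗ[ℝ] V :=
  ∑ i, ((X.form.flip ((X.restrict W).onb i : V)).smulRight ((X.restrict W).onb i : V))

theorem ScalarProduct.orthProj_apply (X : ScalarProduct V) (W : Submodule ℝ V) (x : V) :
    X.orthProj W x = ∑ i, X.form x ((X.restrict W).onb i : V) • ((X.restrict W).onb i : V) := by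
  simp [ScalarProduct.orthProj, LinearMap.sum_apply]

theorem ScalarProduct.orthProj_mem (X : ScalarProduct V) (W : Submodule ℝ V) (x : V) :
    X.orthProj W x ∈ W := by
  rw [X.orthProj_apply]
  exact W.sum_mem fun i _ => W.smul_mem _ ((X.restrict W).onb i).2

theorem ScalarProduct.form_orthProj (X : ScalarProduct V) (W : Submodule ℝ V) (x : V) {w : V}
    (hw : w ∈ W) : X.form (X.orthProj W x) w = X.form x w := by
  have h : ∀ i, X.form (X.orthProj W x) ((X.restrict W).onb i : V)
      = X.form x ((X.restrict W).onb i : V) := fun i => by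
    have ho : ∀ j, X.form ((X.restrict W).onb j : V) ((X.restrict W).onb i : V)
      = if j = i then 1 else 0 := fun j => (X.restrict W).form_onb j i
    rw [X.orthProj_apply, map_sum, LinearMap.sum_apply]
    simp [ho]
  have h2 : (X.form (X.orthProj W x)).comp W.subtype = (X.form x).comp W.subtype :=
    (X.restrict W).onb.ext h
  exact congrArg (fun l : W →ₗ[ℝ] ℝ => l ⟨w, hw⟩) h2

theorem ScalarProduct.orthProj_eq_self (X : ScalarProduct V) {W : Submodule ℝ V} {x : V}
    (hx : x ∈ W) : X.orthProj W x = x := by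
  by_contra hne
  have h1 := X.pos _ (sub_ne_zero.2 hne)
  have h2 := X.form_orthProj W x (W.sub_mem (X.orthProj_mem W x) hx)
  rw [map_sub X.form, LinearMap.sub_apply, h2, sub_self] at h1
  exact h1.false

end OrthogonalProjection

section LocallyConstant
variable {F : Type*} [NormedAddCommGroup F] [NormedSpace ℝ F]
  {M : Type*} [TopologicalSpace M] [ChartedSpace F M] [IsManifold 𝓘(ℝ, F) 1 M]

theorem isLocallyConstant_of_hasMFDerivAt_zero {g : M → ℝ}
    (hg : ∀ x, HasMFDerivAt 𝓘(ℝ, F) 𝓘(ℝ, ℝ) g x 0) : IsLocallyConstant g := by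
  rw [IsLocallyConstant.iff_eventually_eq]
  intro x
  set κ := extChartAt 𝓘(ℝ, F) x with hκ
  have ht : κ.target ∈ 𝓝 (κ x) := extChartAt_target_mem_nhds (I := 𝓘(ℝ, F)) x
  obtain ⟨r, hr, hball⟩ := Metric.mem_nhds_iff.1 ht
  have hd : ∀ t ∈ Metric.ball (κ x) r, HasFDerivAt (g ∘ κ.symm) (0 : F →L[ℝ] ℝ) t := by
    intro t htb
    have h1 : MDifferentiableAt 𝓘(ℝ, F) 𝓘(ℝ, F) κ.symm t := by
      have := mdifferentiableWithinAt_extChartAt_symm (I := 𝓘(ℝ, F)) (hball htb)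
      rwa [modelWithCornersSelf_coe, Set.range_id, mdifferentiableWithinAt_univ] at this
    have h2 := (hg (κ.symm t)).comp t h1.hasMFDerivAt
    rw [ContinuousLinearMap.zero_comp] at h2
    exact hasMFDerivAt_iff_hasFDerivAt.1 h2
  have hconst : ∀ t ∈ Metric.ball (κ x) r, (g ∘ κ.symm) t = (g ∘ κ.symm) (κ x) := fun t htb =>
    (convex_ball (κ x) r).is_const_of_fderivWithin_eq_zero (𝕜 := ℝ)
      (fun s hs => (hd s hs).differentiableAt.differentiableWithinAt)
      (fun s hs => by
        rw [fderivWithin_of_isOpen Metric.isOpen_ball hs, (hd s hs).fderiv])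
      htb (Metric.mem_ball_self hr)
  have hs : κ.source ∈ 𝓝 x := extChartAt_source_mem_nhds (I := 𝓘(ℝ, F)) x
  have hc : ContinuousAt κ x := continuousAt_extChartAt x
  filter_upwards [hs, hc.eventually (Metric.ball_mem_nhds _ hr)] with y hy hyb
  have := hconst _ hyb
  simpa [κ.left_inv hy, κ.left_inv (mem_extChartAt_source (I := 𝓘(ℝ, F)) x)] using! this

end LocallyConstant

section Bilinear
variable {E : Type*} [NormedAddCommGroup E] [NormedSpace ℝ E] [FiniteDimensional ℝ E]
  {X : Type*} [NormedAddCommGroup X] [NormedSpace ℝ X]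

theorem exists_hasFDerivAt_bilinear (β : E →ₗ[ℝ] E →ₗ[ℝ] ℝ) {f g : X → E} {f' g' : X →L[ℝ] E}
    {a : X} (hf : HasFDerivAt f f' a) (hg : HasFDerivAt g g' a) :
    ∃ D : X →L[ℝ] ℝ, HasFDerivAt (fun x => β (f x) (g x)) D a ∧
      ∀ u, D u = β (f a) (g' u) + β (f' u) (g a) :=
  ⟨_, β.toContinuousBilinearMap.hasFDerivAt_of_bilinear hf hg, fun u => by simp⟩

end Bilinear

section Consequences
variable {E : Type*} [NormedAddCommGroup E] [NormedSpace ℝ E] [CompleteSpace E]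
  {G : Type*} [TopologicalSpace G] [ChartedSpace E G] [Group G] [LieGroup 𝓘(ℝ, E) ∞ G]

variable {F : Type*} [NormedAddCommGroup F] [NormedSpace ℝ F]
  (H : Subgroup G) [ChartedSpace F H]

theorem hasFDerivAt_Ad_subgroup (hι : MDifferentiableAt 𝓘(ℝ, F) 𝓘(ℝ, E) (Subtype.val : H → G) 1)
    (v : E) :
    ∃ D : F →L[ℝ] E,
      HasFDerivAt (fun t => AdCLM E ((chartOne F H).symm t : G) v) D (chartOne F H 1) ∧
      ∀ η : F, D η = Bracket.bracket (L := GroupLieAlgebra 𝓘(ℝ, E) G)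
        (M := GroupLieAlgebra 𝓘(ℝ, E) G) (inclusionDeriv E F H η) v := by
  obtain ⟨D, hD, hDu⟩ := hasFDerivAt_Ad_chart (E := E) (G := G) v
  have h := hι.hasMFDerivAt.2
  simp only [writtenInExtChartAt, modelWithCornersSelf_coe, Set.range_id] at h
  have hj : HasFDerivAt (fun t => chartOne E G ((chartOne F H).symm t : G))
    (show F →L[ℝ] E from mfderiv 𝓘(ℝ, F) 𝓘(ℝ, E) (Subtype.val : H → G) 1) (chartOne F H 1) :=
    hasFDerivWithinAt_univ.1 h
  refine ⟨D.comp (show F →L[ℝ] E from mfderiv 𝓘(ℝ, F) 𝓘(ℝ, E) (Subtype.val : H → G) 1), ?_,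
    fun η => hDu _⟩
  have hb : chartOne E G (((chartOne F H).symm (chartOne F H 1) : H) : G) = chartOne E G 1 := by
    rw [chartOne_symm_one]; rfl
  rw [← hb] at hD
  refine (HasFDerivAt.comp (chartOne F H 1) hD hj).congr_of_eventuallyEq ?_
  have h1 : Tendsto (fun t => ((chartOne F H).symm t : G)) (𝓝 (chartOne F H 1)) (𝓝 1) := by
    refine Tendsto.comp ?_ tendsto_chartOne_symm
    exact continuous_subtype_val.tendsto' _ _ rfl
  filter_upwards [h1.eventually (extChartAt_source_mem_nhds (I := 𝓘(ℝ, E)) (1 : G))] with t ht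
  have : (chartOne E G).symm (chartOne E G ((chartOne F H).symm t : G)) = ((chartOne F H).symm t : G) :=
    (chartOne E G).left_inv ht
  simp [this]

variable [FiniteDimensional ℝ E]

/-- The infinitesimal form of `Ad`-invariance. -/
theorem form_lie_left (Q : ScalarProduct (GroupLieAlgebra 𝓘(ℝ, E) G))
    (hQ : ∀ (x : G) (u v : GroupLieAlgebra 𝓘(ℝ, E) G), Q.form (Ad E x u) (Ad E x v) = Q.form u v)
    (x y z : GroupLieAlgebra 𝓘(ℝ, E) G) : Q.form ⁅x, y⁆ z = - Q.form y ⁅x, z⁆ := by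
  obtain ⟨D, hD, hDu⟩ := hasFDerivAt_Ad_chart (E := E) (G := G) y
  obtain ⟨D', hD', hDu'⟩ := hasFDerivAt_Ad_chart (E := E) (G := G) z
  obtain ⟨D₂, hD₂, hD₂u⟩ := exists_hasFDerivAt_bilinear (E := E) Q.form hD hD'
  have h2 := hD₂.unique ((hasFDerivAt_const (Q.form y z) _).congr_of_eventuallyEq
    (Eventually.of_forall fun p => hQ _ y z))
  have h3 := hD₂u x
  rw [h2, chartOne_symm_one, AdCLM_one] at h3
  have h4 : 0 = Q.form y (D' x) + Q.form (D x) z := h3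
  have h5 : 0 = Q.form y ⁅x, z⁆ + Q.form ⁅x, y⁆ z :=
    h4.trans (congrArg₂ (fun a b => Q.form y a + Q.form b z) (hDu' x) (hDu x))
  linarith

/-- An `Ad(H)`-invariant subspace is invariant under the Lie algebra of `H`. -/
theorem lie_mem_of_invariantSubspace
    (hι : MDifferentiableAt 𝓘(ℝ, F) 𝓘(ℝ, E) (Subtype.val : H → G) 1)
    {𝔥 : LieSubalgebra ℝ (GroupLieAlgebra 𝓘(ℝ, E) G)} (h𝔥 : IsLieAlgebraOf (F := F) H 𝔥)
    {W : Submodule ℝ (GroupLieAlgebra 𝓘(ℝ, E) G)}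
    (hW : InvariantSubspace (fun x : H => Ad E (x : G)) W)
    {ξ w : GroupLieAlgebra 𝓘(ℝ, E) G} (hξ : ξ ∈ 𝔥) (hw : w ∈ W) : ⁅ξ, w⁆ ∈ W := by
  have hξ' : ξ ∈ LinearMap.range (inclusionDeriv E F H) := by
    rw [← h𝔥]; exact hξ
  obtain ⟨η, rfl⟩ := hξ'
  obtain ⟨D, hD, hDu⟩ := hasFDerivAt_Ad_subgroup H hι w
  rw [← Subspace.forall_mem_dualAnnihilator_apply_eq_zero_iff]
  intro ℓ hℓ
  rw [Submodule.mem_dualAnnihilator] at hℓ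
  have h1 := (LinearMap.toContinuousLinearMap (𝕜 := ℝ) (E := E) (F' := ℝ) ℓ).hasFDerivAt.comp _ hD
  have h2 := h1.unique ((hasFDerivAt_const (0 : ℝ) _).congr_of_eventuallyEq
    (Eventually.of_forall fun p => hℓ _ (hW _ w hw)))
  have h3 := congrArg (fun l : F →L[ℝ] ℝ => l η) h2
  have h4 : ℓ (D η) = 0 := h3
  exact (congrArg ℓ (hDu η)).symm.trans h4

/-- A Lie subalgebra containing the Lie algebra of the connected subgroup `H` is `Ad(H)`-invariant:
if `p` is the `Q`-orthogonal projection onto it, then the functions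
`x ↦ Q (p (Ad x u)) (Ad x w)` on `H` have zero derivative. -/
theorem invariantSubspace_of_le [LieGroup 𝓘(ℝ, F) ∞ H] (hconn : IsConnected (H : Set G))
    (hι : MDifferentiableAt 𝓘(ℝ, F) 𝓘(ℝ, E) (Subtype.val : H → G) 1)
    (Q : ScalarProduct (GroupLieAlgebra 𝓘(ℝ, E) G))
    (hQ : ∀ (x : G) (u v : GroupLieAlgebra 𝓘(ℝ, E) G), Q.form (Ad E x u) (Ad E x v) = Q.form u v)
    {𝔥 𝔰 : LieSubalgebra ℝ (GroupLieAlgebra 𝓘(ℝ, E) G)} (h𝔥 : IsLieAlgebraOf (F := F) H 𝔥)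
    (hle : 𝔥 ≤ 𝔰) : InvariantSubspace (fun x : H => Ad E (x : G)) 𝔰.toSubmodule := by
  set p := Q.orthProj 𝔰.toSubmodule with hp
  -- `ad ξ` preserves `𝔰` and, being skew, its orthogonal complement
  have hpcomm : ∀ ξ ∈ 𝔥, ∀ u, p ⁅ξ, u⁆ = ⁅ξ, p u⁆ := by
    intro ξ hξ u
    have h1 : ⁅ξ, p u⁆ ∈ 𝔰.toSubmodule := 𝔰.lie_mem (hle hξ) (Q.orthProj_mem _ u)
    have h2 : p ⁅ξ, u - p u⁆ = 0 := by
      have hm := Q.orthProj_mem 𝔰.toSubmodule ⁅ξ, u - p u⁆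
      by_contra hne
      have h3 := Q.pos _ hne
      rw [Q.form_orthProj _ _ hm, form_lie_left Q hQ, map_sub, LinearMap.sub_apply,
        Q.form_orthProj _ _ (𝔰.lie_mem (hle hξ) hm), sub_self, neg_zero] at h3
      exact h3.false
    have h4 := Q.orthProj_eq_self h1
    rw [lie_sub, map_sub, sub_eq_zero] at h2
    rw [h2]; exact h4
  set g : E → E → H → ℝ := fun u w x =>
    Q.form (p (Ad E (x : G) u)) (Ad E (x : G) w) with hg
  have hg1 : ∀ u w, HasMFDerivAt 𝓘(ℝ, F) 𝓘(ℝ, ℝ) (g u w) 1 0 := by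
    intro u w
    obtain ⟨D, hD, hDu⟩ := hasFDerivAt_Ad_subgroup H hι u
    obtain ⟨D', hD', hDu'⟩ := hasFDerivAt_Ad_subgroup H hι w
    obtain ⟨D₂, hD₂, hD₂u⟩ := exists_hasFDerivAt_bilinear (E := E) (LinearMap.comp Q.form p) hD hD'
    have h0 : D₂ = 0 := by
      ext η
      have hξ : inclusionDeriv E F H η ∈ 𝔥 := by
        have : inclusionDeriv E F H η ∈ 𝔥.toSubmodule := by
          rw [h𝔥]; exact LinearMap.mem_range_self _ _
        exact this
      have h3 := hD₂u η
      rw [chartOne_symm_one] at h3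
      have h4 : D₂ η = Q.form (p (AdCLM E (1 : G) u)) (D' η) + Q.form (p (D η)) (AdCLM E (1 : G) w) := h3
      rw [AdCLM_one] at h4
      refine h4.trans ((congrArg₂ (fun a b => Q.form (p u) a + Q.form (p b) w)
        (hDu' η) (hDu η)).trans ?_)
      have h5 := hpcomm _ hξ u
      have h6 := form_lie_left Q hQ (inclusionDeriv E F H η) (p u) w
      refine (congrArg (fun b => Q.form (p u) ⁅inclusionDeriv E F H η, (w : GroupLieAlgebra 𝓘(ℝ, E) G)⁆
        + Q.form b w) h5).trans ?_
      exact (congrArg _ h6).trans (add_neg_cancel _)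
    rw [h0] at hD₂
    have hD₃ : HasFDerivAt (g u w ∘ (chartOne F H).symm) (0 : F →L[ℝ] ℝ) (chartOne F H 1) := hD₂
    refine ⟨?_, ?_⟩
    · have hc : ContinuousAt ((g u w ∘ (chartOne F H).symm) ∘ chartOne F H) 1 :=
        ContinuousAt.comp hD₃.continuousAt (continuousAt_extChartAt (I := 𝓘(ℝ, F)) (1 : H))
      refine hc.congr ?_
      filter_upwards [extChartAt_source_mem_nhds (I := 𝓘(ℝ, F)) (1 : H)] with y hy
      exact congrArg (g u w) ((chartOne F H).left_inv hy)
    · simp only [writtenInExtChartAt, modelWithCornersSelf_coe, Set.range_id]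
      exact hD₃.hasFDerivWithinAt
  -- right translations carry the derivative at the identity to the other points
  have hgx : ∀ u w x, HasMFDerivAt 𝓘(ℝ, F) 𝓘(ℝ, ℝ) (g u w) x 0 := by
    intro u w x
    have hr : MDifferentiableAt 𝓘(ℝ, F) 𝓘(ℝ, F) (fun y : H => y * x⁻¹) x :=
      (contMDiff_mul_right (I := 𝓘(ℝ, F)) (n := ∞) (a := x⁻¹)).mdifferentiable (by simp) x
    have h1 : HasMFDerivAt 𝓘(ℝ, F) 𝓘(ℝ, ℝ) (g (Ad E (x : G) u) (Ad E (x : G) w)) (x * x⁻¹) 0 := by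
      rw [mul_inv_cancel]
      exact hg1 _ _
    have h2 := HasMFDerivAt.comp x h1 hr.hasMFDerivAt
    rw [ContinuousLinearMap.zero_comp] at h2
    refine h2.congr_of_eventuallyEq (Eventually.of_forall fun y => ?_)
    have hA : ∀ v : E, Ad E (y : G) v = Ad E ((y * x⁻¹ : H) : G) (Ad E (x : G) v) := fun v => by
      have h3 := congrArg (fun l : E →L[ℝ] E => l v) (AdCLM_mul (E := E) ((y * x⁻¹ : H) : G) (x : G))
      have h4 : ((y * x⁻¹ : H) : G) * (x : G) = y := by simp
      rw [h4] at h3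
      exact h3
    simp only [hg, Function.comp_def]
    exact congrArg₂ (fun a b => Q.form (p a) b) (hA u) (hA w)
  have hman : IsManifold 𝓘(ℝ, F) ∞ H := (inferInstance : ContMDiffMul 𝓘(ℝ, F) ∞ H).toIsManifold
  have hman : IsManifold 𝓘(ℝ, F) 1 H := .of_le (n := ∞) (by norm_cast)
  have : ConnectedSpace H := isConnected_iff_connectedSpace.1 hconn
  intro x u hu
  have key : p (Ad E (x : G) u) = Ad E (x : G) u := by
    refine Q.eq_of_forall_form_eq fun w => ?_
    obtain ⟨w', rfl⟩ : ∃ w', Ad E (x : G) w' = w := by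
      refine ⟨Ad E (x : G)⁻¹ w, ?_⟩
      have h3 := congrArg (fun l : E →L[ℝ] E => l w) (AdCLM_mul (E := E) (x : G) (x : G)⁻¹)
      rw [mul_inv_cancel, AdCLM_one] at h3
      exact h3.symm
    have h1 : g u w' x = g u w' 1 :=
      (isLocallyConstant_of_hasMFDerivAt_zero (hgx u w')).apply_eq_of_preconnectedSpace x 1
    have h2 : g u w' 1 = Q.form u w' := by
      have h3 : ∀ v : E, Ad E ((1 : H) : G) v = v := fun v =>
        congrArg (fun l : E →L[ℝ] E => l v) (AdCLM_one (E := E) (G := G))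
      have h4 : p u = u := Q.orthProj_eq_self hu
      refine (congrArg₂ (fun a b => Q.form (p a) b) (h3 u) (h3 w')).trans ?_
      rw [h4]
    exact h1.trans (h2.trans (hQ _ _ _).symm)
  rw [← key]
  exact Q.orthProj_mem _ _

end Consequences

/-! ### Scalar products diagonal in an orthonormal basis -/

section ScalarProducts
variable {V : Type*} [AddCommGroup V] [Module ℝ V]

theorem ScalarProduct.form_self_nonneg (X : ScalarProduct V) (v : V) : 0 ≤ X.form v v := by
  by_cases h : v = 0
  · simp [h]
  · exact (X.pos v h).le

theorem ScalarProduct.eq_zero_of_form_self (X : ScalarProduct V) {v : V} (h : X.form v v = 0) :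
    v = 0 := by
  by_contra hv
  exact (X.pos v hv).ne' h

variable [FiniteDimensional ℝ V]

theorem ScalarProduct.sum_form_smul_onb (X : ScalarProduct V) (v : V) :
    ∑ i, X.form v (X.onb i) • X.onb i = v := by
  refine X.eq_of_forall_form_eq fun w => ?_
  have h : X.form (∑ i, X.form v (X.onb i) • X.onb i) = X.form v :=
    X.onb.ext fun j => by
      rw [map_sum, LinearMap.sum_apply]
      simp [X.form_onb]
  rw [h]

/-- An orthonormal family indexed by `Fin (finrank V)` is a basis. -/
theorem ScalarProduct.sum_form_smul_of_orthonormal (X : ScalarProduct V)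
    {f : Fin (Module.finrank ℝ V) → V} (hf : ∀ i j, X.form (f i) (f j) = if i = j then 1 else 0)
    (v : V) : ∑ i, X.form v (f i) • f i = v := by
  have hli : LinearIndependent ℝ f := by
    rw [Fintype.linearIndependent_iff]
    intro g hg i
    have h := congrArg (fun x => X.form x (f i)) hg
    simpa [map_sum, LinearMap.sum_apply, hf] using h
  have hspan := hli.span_eq_top_of_card_eq_finrank' (by simp)
  refine X.eq_of_forall_form_eq fun w => ?_
  have h : X.form (∑ i, X.form v (f i) • f i) = X.form v :=
    (Module.Basis.mk hli hspan.ge).ext fun j => by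
      rw [map_sum, LinearMap.sum_apply]
      simp [hf]
  rw [h]

/-- The spectral theorem: a symmetric bilinear form is diagonal in some basis orthonormal for the
given scalar product. -/
theorem ScalarProduct.exists_orthonormal_diagonal (X : ScalarProduct V)
    (β : LinearMap.BilinForm ℝ V) (hβ : ∀ x y, β x y = β y x) :
    ∃ (f : Fin (Module.finrank ℝ V) → V) (l : Fin (Module.finrank ℝ V) → ℝ),
      (∀ i j, X.form (f i) (f j) = if i = j then 1 else 0) ∧
      ∀ i x, β (f i) x = l i * X.form (f i) x := by
  let core : InnerProductSpace.Core ℝ V :=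
    { inner := fun x y => X.form x y
      conj_inner_symm := fun x y => by simpa using X.symm y x
      re_inner_nonneg := fun x => by simpa using X.form_self_nonneg x
      add_left := fun x y z => by simp
      smul_left := fun x y r => by simp
      definite := fun x hx => X.eq_zero_of_form_self hx }
  let C : V →ₗ[ℝ] V := ∑ i, (β.flip (X.onb i)).smulRight (X.onb i)
  have hC : ∀ x y, X.form (C x) y = β x y := by
    intro x y
    have h1 : C x = ∑ i, β x (X.onb i) • X.onb i := by simp [C, LinearMap.sum_apply]
    have h : X.form (C x) = β x := X.onb.ext fun j => by
      rw [h1, map_sum, LinearMap.sum_apply]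
      simp [X.form_onb]
    rw [h]
  let _ : NormedAddCommGroup V := core.toNormedAddCommGroup
  let _ : InnerProductSpace ℝ V := InnerProductSpace.ofCore core.toCore
  have hsym : C.IsSymmetric := fun x y => by
    change X.form (C x) y = X.form x (C y)
    rw [hC, X.symm, hC, hβ]
  refine ⟨hsym.eigenvectorBasis rfl, hsym.eigenvalues rfl, fun i j => ?_, fun i x => ?_⟩
  · exact orthonormal_iff_ite.mp (hsym.eigenvectorBasis rfl).orthonormal i j
  · rw [← hC, hsym.apply_eigenvectorBasis]
    simp

/-- On a finite-dimensional space every bilinear form is bounded by any scalar product. -/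
theorem ScalarProduct.exists_form_le (X : ScalarProduct V) (β : LinearMap.BilinForm ℝ V) :
    ∃ C : ℝ, 0 ≤ C ∧ ∀ v, β v v ≤ C * X.form v v := by
  refine ⟨∑ i, ∑ j, |β (X.onb i) (X.onb j)|, by positivity, fun v => ?_⟩
  have hsq : ∀ i, X.form v (X.onb i) ^ 2 ≤ X.form v v := fun i => by
    have h := X.form_self_nonneg (v - X.form v (X.onb i) • X.onb i)
    have h1 := X.form_onb i i
    have h2 := X.symm (X.onb i) v
    simp only [map_sub, map_smul, LinearMap.sub_apply, LinearMap.smul_apply, smul_eq_mul, h2] at h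
    rw [h1] at h
    simp at h
    nlinarith
  have hv : β v v = ∑ i, ∑ j, X.form v (X.onb i) * X.form v (X.onb j) * β (X.onb i) (X.onb j) := by
    conv_lhs => rw [← X.sum_form_smul_onb v]
    simp only [map_sum, LinearMap.sum_apply, map_smul, LinearMap.smul_apply, smul_eq_mul,
      Finset.mul_sum]
    rw [Finset.sum_comm]
    refine Finset.sum_congr rfl fun i _ => Finset.sum_congr rfl fun j _ => ?_
    ring
  rw [hv, Finset.sum_mul]
  refine Finset.sum_le_sum fun i _ => ?_
  rw [Finset.sum_mul]
  refine Finset.sum_le_sum fun j _ => ?_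
  refine (le_abs_self _).trans ?_
  rw [abs_mul, mul_comm]
  refine mul_le_mul_of_nonneg_left ?_ (abs_nonneg _)
  rw [abs_le]
  constructor <;> nlinarith [hsq i, hsq j, sq_nonneg (X.form v (X.onb i) - X.form v (X.onb j)),
    sq_nonneg (X.form v (X.onb i) + X.form v (X.onb j))]

theorem ScalarProduct.orthProj_eq_zero (X : ScalarProduct V) {W : Submodule ℝ V} {x : V}
    (hx : ∀ w ∈ W, X.form x w = 0) : X.orthProj W x = 0 := by
  have hm := X.orthProj_mem W x
  exact X.eq_zero_of_form_self ((X.form_orthProj W x hm).trans (hx _ hm))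

end ScalarProducts

section Diagonal
variable {L : Type*} [LieRing L] [LieAlgebra ℝ L] {ι : Type*}

/-- The vectors `f a`, `a ∈ J`, form a `Q`-orthonormal basis of `W` in which the scalar product `X`
on `W` is diagonal, with `1 / μ a` as its diagonal entries. -/
structure IsDiagonal (Q : ScalarProduct L) {W : Submodule ℝ L} (X : ScalarProduct W)
    (f : ι → L) (J : Finset ι) (μ : ι → ℝ) : Prop where
  mem : ∀ a ∈ J, f a ∈ W
  pos : ∀ a ∈ J, 0 < μ a
  orthonormal : ∀ a ∈ J, ∀ b ∈ J, a ≠ b → Q.form (f a) (f b) = 0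
  norm : ∀ a ∈ J, Q.form (f a) (f a) = 1
  expand : ∀ x ∈ W, ∑ a ∈ J, Q.form x (f a) • f a = x
  form_eq : ∀ u v : W, X.form u v = ∑ a ∈ J, Q.form u (f a) * Q.form v (f a) / μ a

variable {Q : ScalarProduct L} {W : Submodule ℝ L} {X : ScalarProduct W}
  {f : ι → L} {J : Finset ι} {μ : ι → ℝ}

theorem IsDiagonal.form_apply (hd : IsDiagonal Q X f J μ) (u : W) {a : ι} (ha : a ∈ J) :
    μ a * X.form u ⟨f a, hd.mem a ha⟩ = Q.form u (f a) := by
  rw [hd.form_eq, Finset.sum_eq_single_of_mem a ha]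
  · have := (hd.pos a ha).ne'
    simp only [hd.norm a ha]
    field_simp
  · intro b hb hba
    simp only
    rw [hd.orthonormal a ha b hb (Ne.symm hba)]
    simp

theorem isDiagonal_restrict (Q : ScalarProduct L) (W : Submodule ℝ L) {f : ι → L} {J : Finset ι}
    (hmem : ∀ a ∈ J, f a ∈ W) (ho : ∀ a ∈ J, ∀ b ∈ J, a ≠ b → Q.form (f a) (f b) = 0)
    (hn : ∀ a ∈ J, Q.form (f a) (f a) = 1)
    (he : ∀ x ∈ W, ∑ a ∈ J, Q.form x (f a) • f a = x) :
    IsDiagonal Q (Q.restrict W) f J 1 where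
  mem := hmem
  pos _ _ := one_pos
  orthonormal := ho
  norm := hn
  expand := he
  form_eq u v := by
    have h : Q.form u v = ∑ a ∈ J, Q.form u (f a) * Q.form (f a) v := by
      conv_lhs => rw [← he u u.2]
      simp [map_sum, LinearMap.sum_apply]
    refine h.trans (Finset.sum_congr rfl fun a _ => ?_)
    rw [Q.symm (f a)]
    simp

variable [FiniteDimensional ℝ L]

theorem IsDiagonal.tr_eq (hd : IsDiagonal Q X f J μ) (β : LinearMap.BilinForm ℝ L) :
    X.tr (fun x => β x x) = ∑ a ∈ J, μ a * β (f a) (f a) := by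
  have h1 : ∀ x : W, β x x = ∑ a ∈ J, Q.form x (f a) * β (f a) x := fun x => by
    have h := congrArg (fun z => β z x) (hd.expand x x.2)
    simp only [map_sum, LinearMap.sum_apply, map_smul, LinearMap.smul_apply, smul_eq_mul] at h
    exact h.symm
  simp only [ScalarProduct.tr, h1]
  rw [Finset.sum_comm]
  refine Finset.sum_congr rfl fun a ha => ?_
  have h2 := congrArg (fun z : W => β (f a) z) (X.sum_form_smul_onb ⟨f a, hd.mem a ha⟩)
  simp only [Submodule.coe_sum, Submodule.coe_smul, map_sum, map_smul, smul_eq_mul] at h2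
  rw [← h2, Finset.mul_sum]
  refine Finset.sum_congr rfl fun k _ => ?_
  rw [← hd.form_apply (X.onb k) ha, X.symm, mul_assoc]

theorem coe_proj (Q : ScalarProduct L) (W : Submodule ℝ L) (x : L) :
    (proj Q W x : L) = Q.orthProj W x := by
  rw [Q.orthProj_apply, proj]
  simp

theorem IsDiagonal.form_proj (hd : IsDiagonal Q X f J μ) (x : L) :
    X.form (proj Q W x) (proj Q W x) = ∑ a ∈ J, Q.form x (f a) ^ 2 / μ a := by
  rw [hd.form_eq]
  refine Finset.sum_congr rfl fun a ha => ?_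
  rw [coe_proj, Q.form_orthProj _ _ (hd.mem a ha), sq]

theorem IsDiagonal.tr_sum_sq (hd : IsDiagonal Q X f J μ) {κ : Type*} (K : Finset κ) (w : κ → ℝ)
    (l : κ → L →ₗ[ℝ] ℝ) :
    X.tr (fun x => ∑ c ∈ K, w c * l c x ^ 2) = ∑ a ∈ J, μ a * ∑ c ∈ K, w c * l c (f a) ^ 2 := by
  have h := hd.tr_eq (∑ c ∈ K, w c • (l c).smulRight (l c))
  simpa [LinearMap.sum_apply, sq] using h

theorem deltaNormSq_eq {U₁ U₂ U₃ : Submodule ℝ L} {X₁ : ScalarProduct U₁}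
    {X₂ : ScalarProduct U₂} {X₃ : ScalarProduct U₃} {J₁ J₂ J₃ : Finset ι} {μ₁ μ₂ μ₃ : ι → ℝ}
    (h₁ : IsDiagonal Q X₁ f J₁ μ₁) (h₂ : IsDiagonal Q X₂ f J₂ μ₂) (h₃ : IsDiagonal Q X₃ f J₃ μ₃) :
    deltaNormSq Q X₁ X₂ X₃ = ∑ a ∈ J₂, ∑ b ∈ J₃, ∑ c ∈ J₁,
      μ₂ a * μ₃ b * Q.form ⁅f a, f b⁆ (f c) ^ 2 / μ₁ c := by
  have hin : ∀ x : L, X₃.tr (fun y => X₁.form (proj Q U₁ ⁅x, (y : L)⁆) (proj Q U₁ ⁅x, (y : L)⁆))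
      = ∑ p ∈ J₃ ×ˢ J₁, (μ₃ p.1 / μ₁ p.2) *
        ((LinearMap.flip Q.form (f p.2)).comp (LieModule.toEnd ℝ L L (f p.1))) x ^ 2 := fun x => by
    have h := h₃.tr_sum_sq J₁ (fun c => (μ₁ c)⁻¹)
      (fun c => (LinearMap.flip Q.form (f c)).comp (LieModule.toEnd ℝ L L x))
    simp only [h₁.form_proj]
    rw [Finset.sum_product]
    refine Eq.trans ?_ (h.trans ?_)
    · congr 1
      funext y
      refine Finset.sum_congr rfl fun c _ => ?_
      simp [div_eq_inv_mul]
    · refine Finset.sum_congr rfl fun b _ => ?_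
      rw [Finset.mul_sum]
      refine Finset.sum_congr rfl fun c _ => ?_
      have h5 : ⁅x, f b⁆ = - ⁅f b, x⁆ := (lie_skew _ _).symm
      simp only [LinearMap.comp_apply, LieModule.toEnd_apply_apply, LinearMap.flip_apply, h5,
        map_neg, neg_sq]
      ring
  rw [deltaNormSq]
  simp only [hin]
  rw [h₂.tr_sum_sq]
  refine Finset.sum_congr rfl fun a _ => ?_
  rw [Finset.mul_sum, Finset.sum_product]
  refine Finset.sum_congr rfl fun b _ => Finset.sum_congr rfl fun c _ => ?_
  have h5 : ⁅f b, f a⁆ = - ⁅f a, f b⁆ := (lie_skew _ _).symm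
  simp only [LinearMap.comp_apply, LieModule.toEnd_apply_apply, LinearMap.flip_apply, h5,
    map_neg]
  ring

end Diagonal

/-! ### Frames -/

section Frames
variable {L : Type*} [LieRing L] [LieAlgebra ℝ L]

/-- The structure constants `Q([f a, f b], f c)` of a family of vectors. -/
def structConst {ι : Type*} (Q : ScalarProduct L) (f : ι → L) (a b c : ι) : ℝ :=
  Q.form ⁅f a, f b⁆ (f c)

/-- The functional `Ŝ` in terms of a `Q`-orthonormal basis `f` adapted to `𝔥 ⊂ 𝔨 ⊂ 𝔤` which
diagonalizes the scalar product on `𝔫 = 𝔨 ⊖ 𝔥`: here `J` and `K` index the vectors in `𝔫` and in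
`𝔩 = 𝔤 ⊖ 𝔨`, and `μ a` is the inverse of the length squared of `f a`. -/
def frameS {ι : Type*} (Q : ScalarProduct L) (f : ι → L) (J K : Finset ι) (μ : ι → ℝ) : ℝ :=
  -(1 / 2) * ∑ a ∈ J, μ a * killingForm ℝ L (f a) (f a)
    - (1 / 2) * ∑ a ∈ J, ∑ b ∈ K, ∑ c ∈ K, μ a * structConst Q f a b c ^ 2
    - (1 / 4) * ∑ a ∈ J, ∑ b ∈ J, ∑ c ∈ J, μ a * μ b * structConst Q f a b c ^ 2 / μ c

/-- Coordinates for pairs `(𝔨, h)` with `𝔥 ⊊ 𝔨 ⊊ 𝔤` and `h` an invariant scalar product on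
`𝔫 = 𝔨 ⊖ 𝔥` of trace one: `f` is a `Q`-orthonormal basis of `𝔤`, the vectors with index in `J` and
`K` span `𝔫` and `𝔩`, the others span `𝔥`, and `h (f a) (f b) = δ / μ a` on `J`. Outside `J` the
weights `μ` vanish. The bilinear form `T` represents the metric on `𝔪`. The field `invariant` says
that the form dual to `h` is invariant. -/
structure IsFrame {S : Type*} (ρ : S → L →ₗ[ℝ] L) (Q : ScalarProduct L) (𝔥 : LieSubalgebra ℝ L)
    (T : LinearMap.BilinForm ℝ L) (f : Fin (Module.finrank ℝ L) → L)
    (J K : Finset (Fin (Module.finrank ℝ L))) (μ : Fin (Module.finrank ℝ L) → ℝ) : Prop where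
  orthonormal : ∀ a b, Q.form (f a) (f b) = if a = b then 1 else 0
  disjoint : ∀ a ∈ J, a ∉ K
  mem : ∀ a, a ∉ J → a ∉ K → f a ∈ 𝔥
  perp : ∀ a, a ∈ J ∨ a ∈ K → ∀ x ∈ 𝔥, Q.form x (f a) = 0
  pos : ∀ a ∈ J, 0 < μ a
  zero : ∀ a, a ∉ J → μ a = 0
  nonempty : K.Nonempty
  closed : ∀ a b c, a ∉ K → b ∉ K → c ∈ K → structConst Q f a b c = 0
  trace : ∑ a ∈ J, μ a * T (f a) (f a) = 1
  invariant : ∀ x u v, ∑ a ∈ J, μ a * (Q.form (f a) (ρ x u) * Q.form (f a) (ρ x v))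
    = ∑ a ∈ J, μ a * (Q.form (f a) u * Q.form (f a) v)

theorem mem_ominus {Q : ScalarProduct L} {U W : Submodule ℝ L} {x : L} :
    x ∈ ominus Q U W ↔ x ∈ U ∧ ∀ w ∈ W, Q.form w x = 0 := by
  simp [ominus, LinearMap.BilinForm.mem_orthogonal_iff]

/-- The operator `∑ μ a ⟨f a, ·⟩ f a` with eigenvalues `μ a`. -/
def frameOp {ι : Type*} (Q : ScalarProduct L) (f : ι → L) (J : Finset ι) (μ : ι → ℝ) : L →ₗ[ℝ] L :=
  ∑ a ∈ J, μ a • (Q.form (f a)).smulRight (f a)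

theorem frameOp_apply {ι : Type*} {Q : ScalarProduct L} (f : ι → L) (J : Finset ι) (μ : ι → ℝ) (w : L) :
    frameOp Q f J μ w = ∑ a ∈ J, (μ a * Q.form (f a) w) • f a := by
  simp [frameOp, LinearMap.sum_apply, smul_smul]

theorem form_frameOp {ι : Type*} {Q : ScalarProduct L} (f : ι → L) (J : Finset ι) (μ : ι → ℝ) (u v : L) :
    Q.form (frameOp Q f J μ u) v = ∑ a ∈ J, μ a * (Q.form (f a) u * Q.form (f a) v) := by
  simp [frameOp_apply, map_sum, LinearMap.sum_apply, mul_assoc]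

theorem IsDiagonal.frameOp_mem {ι : Type*} {Q : ScalarProduct L} {W : Submodule ℝ L}
    {X : ScalarProduct W} {f : ι → L} {J : Finset ι} {μ : ι → ℝ} (hd : IsDiagonal Q X f J μ)
    (w : L) : frameOp Q f J μ w ∈ W := by
  rw [frameOp_apply]
  exact Submodule.sum_mem _ fun a ha => Submodule.smul_mem _ _ (hd.mem a ha)

/-- On `W` the operator `frameOp` is the inverse of the operator representing `X`. -/
theorem IsDiagonal.form_of_eq_frameOp {ι : Type*} {Q : ScalarProduct L} {W : Submodule ℝ L}
    {X : ScalarProduct W} {f : ι → L} {J : Finset ι} {μ : ι → ℝ} (hd : IsDiagonal Q X f J μ)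
    {w : L} {y : W} (hy : (y : L) = frameOp Q f J μ w) (z : W) : X.form y z = Q.form w z := by
  rw [hd.form_eq, hy]
  have h1 : Q.form w (z : L) = ∑ a ∈ J, Q.form z (f a) * Q.form w (f a) := by
    conv_lhs => rw [← hd.expand z z.2]
    simp [map_sum]
  rw [h1]
  refine Finset.sum_congr rfl fun a ha => ?_
  have h2 : Q.form (frameOp Q f J μ w) (f a) = μ a * Q.form w (f a) := by
    rw [form_frameOp, Finset.sum_eq_single_of_mem a ha, hd.norm a ha, Q.symm (f a), mul_one]
    intro b hb hba
    rw [hd.orthonormal b hb a ha hba]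
    ring
  have := (hd.pos a ha).ne'
  rw [h2]
  field_simp

variable [FiniteDimensional ℝ L]

theorem hatS_eq_frameS {ι : Type*} {Q : ScalarProduct L} {𝔥 𝔨 : LieSubalgebra ℝ L}
    {h : ScalarProduct (nSpace Q 𝔥 𝔨)} {f : ι → L} {J K : Finset ι} {μ : ι → ℝ}
    (hn : IsDiagonal Q h f J μ) (hl : IsDiagonal Q (Q.restrict (lSpace Q 𝔨)) f K 1) :
    hatS Q 𝔥 𝔨 h = frameS Q f J K μ := by
  rw [hatS, frameS, deltaNormSq_eq hl hn hl, deltaNormSq_eq hn hn hn, hn.tr_eq]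
  simp [structConst]

variable {S : Type*} {ρ : S → L →ₗ[ℝ] L} {Q : ScalarProduct L}

theorem surjOn_of_invariantSubspace (hρ : ∀ x u v, Q.form (ρ x u) (ρ x v) = Q.form u v)
    {W : Submodule ℝ L} (hW : InvariantSubspace ρ W) (x : S) {w : L} (hw : w ∈ W) :
    ∃ v ∈ W, ρ x v = w := by
  have hinj : Function.Injective ((ρ x).restrict (hW x)) := by
    rw [← LinearMap.ker_eq_bot, LinearMap.ker_eq_bot']
    intro m hm
    have h1 : ρ x m = 0 := congrArg Subtype.val hm
    have h2 := hρ x m m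
    rw [h1] at h2
    simp only [map_zero] at h2
    exact Subtype.ext (Q.eq_zero_of_form_self h2.symm)
  obtain ⟨v, hv⟩ := LinearMap.injective_iff_surjective.1 hinj ⟨w, hw⟩
  exact ⟨v, v.2, congrArg Subtype.val hv⟩

theorem surjective_of_form_eq (hρ : ∀ x u v, Q.form (ρ x u) (ρ x v) = Q.form u v) (x : S) :
    Function.Surjective (ρ x) := fun w => by
  obtain ⟨v, -, hv⟩ := surjOn_of_invariantSubspace hρ (W := ⊤) (fun _ _ _ => trivial) x
    (w := w) trivial
  exact ⟨v, hv⟩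

theorem invariantSubspace_ominus (hρ : ∀ x u v, Q.form (ρ x u) (ρ x v) = Q.form u v)
    {U W : Submodule ℝ L} (hU : InvariantSubspace ρ U) (hW : InvariantSubspace ρ W) :
    InvariantSubspace ρ (ominus Q U W) := by
  intro x v hv
  rw [mem_ominus] at hv ⊢
  refine ⟨hU x v hv.1, fun w hw => ?_⟩
  obtain ⟨w', hw', rfl⟩ := surjOn_of_invariantSubspace hρ hW x hw
  rw [hρ]
  exact hv.2 _ hw'

theorem frameOp_comm (hρ : ∀ x u v, Q.form (ρ x u) (ρ x v) = Q.form u v) {ι : Type*} {f : ι → L}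
    {J : Finset ι} {μ : ι → ℝ}
    (hinv : ∀ x u v, ∑ a ∈ J, μ a * (Q.form (f a) (ρ x u) * Q.form (f a) (ρ x v))
      = ∑ a ∈ J, μ a * (Q.form (f a) u * Q.form (f a) v)) (x : S) (u : L) :
    frameOp Q f J μ (ρ x u) = ρ x (frameOp Q f J μ u) := by
  refine Q.eq_of_forall_form_eq fun w => ?_
  obtain ⟨v, rfl⟩ := surjective_of_form_eq hρ x w
  rw [hρ, form_frameOp, form_frameOp, hinv]

end Frames

/-! ### From subalgebras and scalar products to frames -/

section FrameOfPair
variable {L : Type*} [LieRing L] [LieAlgebra ℝ L] [FiniteDimensional ℝ L]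
  {S : Type*} {ρ : S → L →ₗ[ℝ] L} {Q : ScalarProduct L} {𝔥 : LieSubalgebra ℝ L}

/-- A `Q`-orthonormal basis adapted to `𝔥 ⊂ 𝔨 ⊂ 𝔤` and diagonalizing `h`: it diagonalizes the form
which vanishes on `𝔥`, is `h` on `𝔨 ⊖ 𝔥` and `-Q` on `𝔤 ⊖ 𝔨`, and these summands are told apart by
the sign of the eigenvalue. -/
theorem exists_adapted_basis {𝔨 : LieSubalgebra ℝ L} (hlt : 𝔥 ≤ 𝔨)
    (h : ScalarProduct (nSpace Q 𝔥 𝔨)) :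
    ∃ (f : Fin (Module.finrank ℝ L) → L) (l : Fin (Module.finrank ℝ L) → ℝ),
      (∀ a b, Q.form (f a) (f b) = if a = b then 1 else 0) ∧
      (∀ a, 0 < l a → f a ∈ nSpace Q 𝔥 𝔨) ∧ (∀ a, l a < 0 → f a ∈ lSpace Q 𝔨) ∧
      (∀ a, l a = 0 → f a ∈ 𝔥) ∧
      ∀ u v : nSpace Q 𝔥 𝔨, h.form u v = ∑ a, l a * (Q.form u (f a) * Q.form v (f a)) := by
  set Pk := Q.orthProj 𝔨.toSubmodule with hPk
  set Ph := Q.orthProj 𝔥.toSubmodule with hPh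
  have hπ : ∀ x, (Pk - Ph) x ∈ nSpace Q 𝔥 𝔨 := fun x => by
    rw [mem_ominus]
    refine ⟨𝔨.toSubmodule.sub_mem (Q.orthProj_mem _ _) (hlt (Q.orthProj_mem 𝔥.toSubmodule x)), fun w hw => ?_⟩
    rw [Q.symm, LinearMap.sub_apply, map_sub, LinearMap.sub_apply, Q.form_orthProj _ _ (hlt hw : w ∈ 𝔨.toSubmodule),
      Q.form_orthProj _ _ hw, sub_self]
  set π : L →ₗ[ℝ] nSpace Q 𝔥 𝔨 := (Pk - Ph).codRestrict _ hπ with hπdef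
  have hl : ∀ x, x - Pk x ∈ lSpace Q 𝔨 := fun x => by
    rw [mem_ominus]
    refine ⟨trivial, fun w hw => ?_⟩
    rw [Q.symm, map_sub, LinearMap.sub_apply, Q.form_orthProj _ _ hw, sub_self]
  set β : LinearMap.BilinForm ℝ L := h.form.compl₁₂ π π -
    (Q.form.compl₁₂ (LinearMap.id - Pk) (LinearMap.id - Pk)) with hβdef
  have hβ : ∀ x y, β x y = h.form (π x) (π y) - Q.form (x - Pk x) (y - Pk y) := fun x y => by
    simp [hβdef]
  have hPk_of_l : ∀ y ∈ lSpace Q 𝔨, Pk y = 0 := fun y hy =>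
    Q.orthProj_eq_zero fun w hw => by rw [Q.symm]; exact (mem_ominus.1 hy).2 w hw
  have hPh_of_l : ∀ y ∈ lSpace Q 𝔨, Ph y = 0 := fun y hy =>
    Q.orthProj_eq_zero fun w hw => by rw [Q.symm]; exact (mem_ominus.1 hy).2 w (hlt hw)
  have hPk_of_n : ∀ y ∈ nSpace Q 𝔥 𝔨, Pk y = y := fun y hy =>
    Q.orthProj_eq_self (mem_ominus.1 hy).1
  have hPh_of_n : ∀ y ∈ nSpace Q 𝔥 𝔨, Ph y = 0 := fun y hy =>
    Q.orthProj_eq_zero fun w hw => by rw [Q.symm]; exact (mem_ominus.1 hy).2 w hw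
  have hπ_of_n : ∀ y : nSpace Q 𝔥 𝔨, π y = y := fun y => by
    ext; simp [hπdef, hPk_of_n y y.2, hPh_of_n y y.2]
  have hπ_of_l : ∀ y ∈ lSpace Q 𝔨, π y = 0 := fun y hy => by
    ext; simp [hπdef, hPk_of_l y hy, hPh_of_l y hy]
  have hπ_of_h : ∀ y ∈ 𝔥, π y = 0 := fun y hy => by
    ext
    have h1 : Pk y = y := Q.orthProj_eq_self (hlt hy)
    have h2 : Ph y = y := Q.orthProj_eq_self hy
    simp [hπdef, h1, h2]
  obtain ⟨f, l, hf, hfl⟩ := Q.exists_orthonormal_diagonal β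
    (fun x y => by rw [hβ, hβ, h.symm, Q.symm])
  -- compare `β (f a) y` with `l a * Q (f a) y` for the three components `y` of `f a`
  have hh : ∀ a, l a * Q.form (Ph (f a)) (Ph (f a)) = 0 := fun a => by
    have h1 := hfl a (Ph (f a))
    have hm : Ph (f a) ∈ 𝔥 := Q.orthProj_mem 𝔥.toSubmodule _
    have h2 : Pk (Ph (f a)) = Ph (f a) := Q.orthProj_eq_self (hlt hm)
    rw [hβ, hπ_of_h _ hm, h2, sub_self, map_zero, map_zero, sub_zero, ← Q.form_orthProj _ _ hm] at h1
    exact h1.symm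
  have hll : ∀ a, - Q.form (f a - Pk (f a)) (f a - Pk (f a))
      = l a * Q.form (f a - Pk (f a)) (f a - Pk (f a)) := fun a => by
    have h1 := hfl a (f a - Pk (f a))
    have h3 : Q.form (f a) (f a - Pk (f a)) = Q.form (f a - Pk (f a)) (f a - Pk (f a)) := by
      have h4 : Q.form (Pk (f a)) (f a - Pk (f a)) = 0 :=
        (mem_ominus.1 (hl (f a))).2 _ (Q.orthProj_mem _ _)
      rw [map_sub Q.form, LinearMap.sub_apply, h4, sub_zero]
    rw [hβ, hπ_of_l _ (hl _), hPk_of_l _ (hl _), sub_zero, map_zero, zero_sub, h3] at h1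
    exact h1
  have hn : ∀ a, h.form (π (f a)) (π (f a))
      = l a * Q.form (π (f a) : L) (π (f a)) := fun a => by
    have h1 := hfl a (π (f a))
    have h3 : Q.form (f a) (π (f a)) = Q.form (π (f a) : L) (π (f a)) := by
      have hm := mem_ominus.1 (π (f a)).2
      have h5 : (π (f a) : L) = Pk (f a) - Ph (f a) := rfl
      have h6 : Q.form (Ph (f a)) (π (f a)) = 0 := hm.2 _ (Q.orthProj_mem _ _)
      have h7 : Q.form (Pk (f a)) (π (f a)) = Q.form (f a) (π (f a)) := Q.form_orthProj _ _ hm.1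
      have h8 := congrArg (fun z => Q.form z (π (f a))) h5
      simp only [map_sub, LinearMap.sub_apply] at h8
      rw [h8, h6, h7, sub_zero]
    rw [hβ, hπ_of_n, hPk_of_n _ (π (f a)).2, sub_self, map_zero, sub_zero, h3] at h1
    exact h1
  have hdec : ∀ x, x = (π x : L) + Ph x + (x - Pk x) := fun x => by
    have h5 : (π x : L) = Pk x - Ph x := rfl
    rw [h5]; abel
  have z1 : ∀ a, l a ≠ 0 → Ph (f a) = 0 := fun a ha =>
    Q.eq_zero_of_form_self ((mul_eq_zero.1 (hh a)).resolve_left ha)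
  have z2 : ∀ a, 0 ≤ l a → f a - Pk (f a) = 0 := fun a ha =>
    Q.eq_zero_of_form_self (by nlinarith [hll a, Q.form_self_nonneg (f a - Pk (f a))])
  have z3 : ∀ a, l a ≤ 0 → π (f a) = 0 := fun a ha =>
    h.eq_zero_of_form_self (by
      nlinarith [hn a, Q.form_self_nonneg (π (f a) : L), h.form_self_nonneg (π (f a))])
  refine ⟨f, l, hf, fun a ha => ?_, fun a ha => ?_, fun a ha => ?_, fun u v => ?_⟩
  · rw [hdec (f a), z1 a ha.ne', z2 a ha.le, add_zero, add_zero]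
    exact (π (f a)).2
  · rw [hdec (f a), z1 a ha.ne, z3 a ha.le, Submodule.coe_zero, add_zero, zero_add]
    exact hl _
  · rw [hdec (f a), z3 a ha.le, z2 a ha.ge, Submodule.coe_zero, add_zero, zero_add]
    exact Q.orthProj_mem 𝔥.toSubmodule _
  · have h1 : h.form u v = β u v := by
      rw [hβ, hπ_of_n, hπ_of_n, hPk_of_n _ u.2]; simp
    rw [h1]
    conv_lhs => rw [← Q.sum_form_smul_of_orthonormal hf (u : L)]
    simp only [map_sum, LinearMap.sum_apply, map_smul, LinearMap.smul_apply, smul_eq_mul, hfl]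
    refine Finset.sum_congr rfl fun a _ => ?_
    rw [Q.symm (f a)]
    ring

variable {T : ScalarProduct (mSpace Q 𝔥)} {T' : LinearMap.BilinForm ℝ L}

/-- Every scalar product in `𝓜_T(𝔨)` on a proper subalgebra `𝔨` is described by a frame. -/
theorem exists_isFrame (hρ : ∀ x u v, Q.form (ρ x u) (ρ x v) = Q.form u v)
    (hT : ∀ u v : mSpace Q 𝔥, T' u v = T.form u v)
    {𝔨 : LieSubalgebra ℝ L} (hlt : 𝔥 < 𝔨) (hne : 𝔨 ≠ ⊤)
    (h𝔥 : InvariantSubspace ρ 𝔥.toSubmodule) (h𝔨 : InvariantSubspace ρ 𝔨.toSubmodule)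
    {h : ScalarProduct (nSpace Q 𝔥 𝔨)} (hM : h ∈ MT ρ Q 𝔥 T 𝔨) :
    ∃ f J K μ, IsFrame ρ Q 𝔥 T' f J K μ ∧ frameS Q f J K μ = hatS Q 𝔥 𝔨 h := by
  obtain ⟨f, l, hf, hfn, hfl, hfh, hform⟩ := exists_adapted_basis hlt.le h
  set J := Finset.univ.filter fun a => 0 < l a with hJ
  set K := Finset.univ.filter fun a => l a < 0 with hK
  set μ : Fin (Module.finrank ℝ L) → ℝ := fun a => if 0 < l a then (l a)⁻¹ else 0 with hμ
  have hμJ : ∀ a ∈ J, μ a = (l a)⁻¹ := fun a ha => by simp [hμ, (Finset.mem_filter.1 ha).2]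
  have mJ : ∀ a, a ∈ J ↔ 0 < l a := fun a => by simp [hJ]
  have mK : ∀ a, a ∈ K ↔ l a < 0 := fun a => by simp [hK]
  have ortho : ∀ a b, a ≠ b → Q.form (f a) (f b) = 0 := fun a b hab => by rw [hf, if_neg hab]
  have norm : ∀ a, Q.form (f a) (f a) = 1 := fun a => by rw [hf, if_pos rfl]
  have hmem : ∀ a, a ∉ J → a ∉ K → f a ∈ 𝔥 := fun a h1 h2 =>
    hfh a (le_antisymm (not_lt.1 fun h => h1 ((mJ a).2 h)) (not_lt.1 fun h => h2 ((mK a).2 h)))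
  have hn : IsDiagonal Q h f J μ :=
    { mem := fun a ha => hfn a ((mJ a).1 ha)
      pos := fun a ha => by rw [hμJ a ha]; exact inv_pos.2 ((mJ a).1 ha)
      orthonormal := fun a _ b _ hab => ortho a b hab
      norm := fun a _ => norm a
      expand := fun x hx => by
        conv_rhs => rw [← Q.sum_form_smul_of_orthonormal hf x]
        refine Finset.sum_subset (Finset.subset_univ _) fun a _ ha => ?_
        have hx' := mem_ominus.1 hx
        have h0 : Q.form x (f a) = 0 := by
          by_cases haK : a ∈ K
          · exact (mem_ominus.1 (hfl a ((mK a).1 haK))).2 x hx'.1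
          · rw [Q.symm]; exact hx'.2 _ (hmem a ha haK)
        rw [h0, zero_smul]
      form_eq := fun u v => by
        rw [hform]
        symm
        refine (Finset.sum_congr rfl fun a ha => ?_).trans
          (Finset.sum_subset (Finset.subset_univ J) fun a _ ha => ?_)
        · rw [hμJ a ha, div_inv_eq_mul, mul_comm]
        · by_cases haK : a ∈ K
          · rw [(mem_ominus.1 (hfl a ((mK a).1 haK))).2 u (mem_ominus.1 u.2).1]
            simp
          · rw [Q.symm u, (mem_ominus.1 u.2).2 _ (hmem a ha haK)]
            simp }
  have hl : IsDiagonal Q (Q.restrict (lSpace Q 𝔨)) f K 1 := by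
    refine isDiagonal_restrict Q _ (fun a ha => hfl a ((mK a).1 ha))
      (fun a _ b _ hab => ortho a b hab) (fun a _ => norm a) fun x hx => ?_
    conv_rhs => rw [← Q.sum_form_smul_of_orthonormal hf x]
    refine Finset.sum_subset (Finset.subset_univ _) fun a _ ha => ?_
    have h0 : Q.form x (f a) = 0 := by
      rw [Q.symm]
      refine (mem_ominus.1 hx).2 _ ?_
      by_cases haJ : a ∈ J
      · exact (mem_ominus.1 (hfn a ((mJ a).1 haJ))).1
      · exact hlt.le (hmem a haJ ha)
    rw [h0, zero_smul]
  have hmem𝔨 : ∀ a, a ∉ K → f a ∈ 𝔨 := fun a ha => by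
    by_cases haJ : a ∈ J
    · exact (mem_ominus.1 (hfn a ((mJ a).1 haJ))).1
    · exact hlt.le (hmem a haJ ha)
  refine ⟨f, J, K, μ, ?_, (hatS_eq_frameS hn hl).symm⟩
  refine
    { orthonormal := hf
      disjoint := fun a ha hb => lt_asymm ((mJ a).1 ha) ((mK a).1 hb)
      mem := hmem
      perp := ?_
      pos := hn.pos
      zero := fun a ha => if_neg fun h => ha ((mJ a).2 h)
      nonempty := ?_
      closed := fun a b c ha hb hc =>
        (mem_ominus.1 (hl.mem c hc)).2 _ (𝔨.lie_mem (hmem𝔨 a ha) (hmem𝔨 b hb))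
      trace := ?_
      invariant := ?_ }
  · rintro a (ha | ha) x hx
    · exact (mem_ominus.1 (hn.mem a ha)).2 x hx
    · exact (mem_ominus.1 (hl.mem a ha)).2 x (hlt.le hx)
  · by_contra hK0
    rw [Finset.not_nonempty_iff_eq_empty] at hK0
    refine hne (eq_top_iff.2 fun x _ => ?_)
    rw [← Q.sum_form_smul_of_orthonormal hf x]
    exact sum_mem fun a _ => 𝔨.smul_mem _ (hmem𝔨 a (by simp [hK0]))
  · rw [← hn.tr_eq, ← hM.2]
    congr 1
    funext x
    exact hT (Submodule.inclusion (ominus_le_ominus_top Q _ _) x)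
      (Submodule.inclusion (ominus_le_ominus_top Q _ _) x)
  · have hnin := invariantSubspace_ominus hρ h𝔨 h𝔥
    have hcomm : ∀ x w, frameOp Q f J μ (ρ x w) = ρ x (frameOp Q f J μ w) := fun x w => by
      have h1 : (⟨_, hn.frameOp_mem (ρ x w)⟩ : nSpace Q 𝔥 𝔨)
          = ⟨_, hnin x _ (hn.frameOp_mem w)⟩ := by
        refine h.eq_of_forall_form_eq fun z => ?_
        obtain ⟨z', hz', hz⟩ := surjOn_of_invariantSubspace hρ hnin x z.2
        rw [hn.form_of_eq_frameOp rfl, ← hz, hρ, hM.1 x ⟨_, hn.frameOp_mem w⟩ ⟨z', hz'⟩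
          ⟨_, hnin x _ (hn.frameOp_mem w)⟩ z rfl hz, hn.form_of_eq_frameOp rfl]
      exact congrArg Subtype.val h1
    intro x u v
    rw [← form_frameOp, ← form_frameOp, hcomm, hρ]

end FrameOfPair

/-! ### From frames to subalgebras and scalar products -/

section PairOfFrame
variable {L : Type*} [LieRing L] [LieAlgebra ℝ L]
  {S : Type*} {ρ : S → L →ₗ[ℝ] L} {Q : ScalarProduct L} {𝔥 : LieSubalgebra ℝ L}
  {T : ScalarProduct (mSpace Q 𝔥)} {T' : LinearMap.BilinForm ℝ L}
  {f : Fin (Module.finrank ℝ L) → L} {J K : Finset (Fin (Module.finrank ℝ L))}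
  {μ : Fin (Module.finrank ℝ L) → ℝ}

theorem IsFrame.ortho (hF : IsFrame ρ Q 𝔥 T' f J K μ) {a b} (hab : a ≠ b) :
    Q.form (f a) (f b) = 0 := by
  rw [hF.orthonormal, if_neg hab]

theorem IsFrame.norm (hF : IsFrame ρ Q 𝔥 T' f J K μ) (a) : Q.form (f a) (f a) = 1 := by
  rw [hF.orthonormal, if_pos rfl]

variable [FiniteDimensional ℝ L]

theorem IsFrame.sum_eq (hF : IsFrame ρ Q 𝔥 T' f J K μ) {x : L} {I : Finset _}
    (hx : ∀ a ∉ I, Q.form x (f a) = 0) : ∑ a ∈ I, Q.form x (f a) • f a = x := by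
  conv_rhs => rw [← Q.sum_form_smul_of_orthonormal hF.orthonormal x]
  exact Finset.sum_subset (Finset.subset_univ _) fun a _ ha => by rw [hx a ha, zero_smul]

/-- The Lie subalgebra `𝔨` described by a frame. -/
def IsFrame.subalgebra (hF : IsFrame ρ Q 𝔥 T' f J K μ) : LieSubalgebra ℝ L where
  carrier := {x | ∀ c ∈ K, Q.form x (f c) = 0}
  add_mem' {x y} hx hy c hc := by simp [hx c hc, hy c hc]
  zero_mem' c _ := by simp
  smul_mem' r x hx c hc := by simp [hx c hc]
  lie_mem' {x y} hx hy c hc := by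
    rw [← hF.sum_eq (I := Finset.univ \ K) (x := x) (fun a ha => hx a (by simpa using ha)),
      ← hF.sum_eq (I := Finset.univ \ K) (x := y) (fun a ha => hy a (by simpa using ha))]
    simp only [sum_lie, lie_sum, smul_lie, lie_smul, map_sum, map_smul, LinearMap.sum_apply,
      LinearMap.smul_apply]
    refine Finset.sum_eq_zero fun b hb => ?_
    rw [Finset.sum_eq_zero fun a ha => ?_, smul_zero]
    have h := hF.closed a b c (by simpa using ha) (by simpa using hb) hc
    rw [structConst] at h
    rw [h, smul_zero]

theorem IsFrame.mem_subalgebra (hF : IsFrame ρ Q 𝔥 T' f J K μ) {x : L} :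
    x ∈ hF.subalgebra ↔ ∀ c ∈ K, Q.form x (f c) = 0 := Iff.rfl

theorem IsFrame.mem_nSpace (hF : IsFrame ρ Q 𝔥 T' f J K μ) {x : L} :
    x ∈ nSpace Q 𝔥 hF.subalgebra ↔ ∀ a ∉ J, Q.form x (f a) = 0 := by
  rw [mem_ominus]
  constructor
  · rintro ⟨h1, h2⟩ a ha
    by_cases haK : a ∈ K
    · exact h1 a haK
    · rw [Q.symm]; exact h2 _ (hF.mem a ha haK)
  · intro h
    refine ⟨fun c hc => h c fun hcJ => hF.disjoint c hcJ hc, fun w hw => ?_⟩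
    rw [← hF.sum_eq h]
    simp only [map_sum, map_smul, smul_eq_mul]
    exact Finset.sum_eq_zero fun a ha => by rw [hF.perp a (Or.inl ha) w hw, mul_zero]

theorem IsFrame.mem_lSpace (hF : IsFrame ρ Q 𝔥 T' f J K μ) {x : L} :
    x ∈ lSpace Q hF.subalgebra ↔ ∀ a ∉ K, Q.form x (f a) = 0 := by
  rw [mem_ominus]
  constructor
  · rintro ⟨-, h2⟩ a ha
    rw [Q.symm]
    exact h2 _ fun c hc => hF.ortho fun hac => ha (hac ▸ hc)
  · intro h
    refine ⟨trivial, fun w hw => ?_⟩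
    rw [← hF.sum_eq h]
    simp only [map_sum, map_smul, smul_eq_mul]
    exact Finset.sum_eq_zero fun a ha => by rw [hw a ha, mul_zero]

/-- The scalar product on `𝔫` described by a frame. -/
def IsFrame.scalarProduct (hF : IsFrame ρ Q 𝔥 T' f J K μ) :
    ScalarProduct (nSpace Q 𝔥 hF.subalgebra) where
  form := ∑ a ∈ J, (μ a)⁻¹ • ((LinearMap.flip Q.form (f a)).comp (Submodule.subtype _)).smulRight
    ((LinearMap.flip Q.form (f a)).comp (Submodule.subtype _))
  symm u v := by
    simp only [LinearMap.sum_apply]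
    refine Finset.sum_congr rfl fun a _ => ?_
    simp [mul_comm]
  pos v hv := by
    have hterm : ∀ a ∈ J, 0 ≤ (μ a)⁻¹ * (Q.form v (f a) * Q.form v (f a)) := fun a ha =>
      mul_nonneg (inv_nonneg.2 (hF.pos a ha).le) (mul_self_nonneg _)
    simp only [LinearMap.sum_apply, LinearMap.smul_apply, LinearMap.smulRight_apply,
      LinearMap.comp_apply, LinearMap.flip_apply, Submodule.subtype_apply, smul_eq_mul]
    refine lt_of_le_of_ne (Finset.sum_nonneg hterm) fun h0 => hv ?_
    have h1 := (Finset.sum_eq_zero_iff_of_nonneg hterm).1 h0.symm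
    ext
    rw [← hF.sum_eq (hF.mem_nSpace.1 v.2)]
    refine Finset.sum_eq_zero fun a ha => ?_
    have h2 := (mul_eq_zero.1 (h1 a ha)).resolve_left (inv_ne_zero (hF.pos a ha).ne')
    rw [mul_self_eq_zero.1 h2, zero_smul]

theorem IsFrame.scalarProduct_form (hF : IsFrame ρ Q 𝔥 T' f J K μ)
    (u v : nSpace Q 𝔥 hF.subalgebra) :
    hF.scalarProduct.form u v = ∑ a ∈ J, Q.form u (f a) * Q.form v (f a) / μ a := by
  simp only [IsFrame.scalarProduct, LinearMap.sum_apply, LinearMap.smul_apply,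
    LinearMap.smulRight_apply, LinearMap.comp_apply, LinearMap.flip_apply, Submodule.subtype_apply,
    smul_eq_mul]
  exact Finset.sum_congr rfl fun a _ => by ring

theorem IsFrame.isDiagonal (hF : IsFrame ρ Q 𝔥 T' f J K μ) :
    IsDiagonal Q hF.scalarProduct f J μ where
  mem := fun _ ha => hF.mem_nSpace.2 fun _ hb => hF.ortho fun hab => hb (hab ▸ ha)
  pos := hF.pos
  orthonormal := fun _ _ _ _ hab => hF.ortho hab
  norm := fun a _ => hF.norm a
  expand _ hx := hF.sum_eq (hF.mem_nSpace.1 hx)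
  form_eq := hF.scalarProduct_form

theorem IsFrame.hatS_eq (hF : IsFrame ρ Q 𝔥 T' f J K μ) :
    hatS Q 𝔥 hF.subalgebra hF.scalarProduct = frameS Q f J K μ :=
  hatS_eq_frameS hF.isDiagonal <| isDiagonal_restrict Q _
    (fun _ ha => hF.mem_lSpace.2 fun _ hb => hF.ortho fun hab => hb (hab ▸ ha))
    (fun _ _ _ _ hab => hF.ortho hab) (fun a _ => hF.norm a)
    (fun _ hx => hF.sum_eq (hF.mem_lSpace.1 hx))

theorem IsFrame.lt_subalgebra (hF : IsFrame ρ Q 𝔥 T' f J K μ) : 𝔥 < hF.subalgebra := by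
  have hJ : J.Nonempty := by
    by_contra h
    rw [Finset.not_nonempty_iff_eq_empty] at h
    simpa [h] using hF.trace
  obtain ⟨a, ha⟩ := hJ
  refine lt_of_le_of_ne (fun x hx c hc => hF.perp c (Or.inr hc) x hx) fun heq => ?_
  have h1 : f a ∈ 𝔥 := by
    rw [heq, hF.mem_subalgebra]
    exact fun c hc => hF.ortho fun hac => hF.disjoint a ha (hac ▸ hc)
  have h2 := hF.perp a (Or.inl ha) _ h1
  rw [hF.norm] at h2
  exact one_ne_zero h2

theorem IsFrame.subalgebra_ne_top (hF : IsFrame ρ Q 𝔥 T' f J K μ) : hF.subalgebra ≠ ⊤ := by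
  intro h
  obtain ⟨c, hc⟩ := hF.nonempty
  have h1 : f c ∈ hF.subalgebra := by rw [h]; trivial
  have h2 := h1 c hc
  rw [hF.norm] at h2
  exact one_ne_zero h2

theorem IsFrame.scalarProduct_mem_MT (hF : IsFrame ρ Q 𝔥 T' f J K μ)
    (hρ : ∀ x u v, Q.form (ρ x u) (ρ x v) = Q.form u v)
    (hT : ∀ u v : mSpace Q 𝔥, T' u v = T.form u v) :
    hF.scalarProduct ∈ MT ρ Q 𝔥 T hF.subalgebra := by
  have hd := hF.isDiagonal
  refine ⟨fun x u v u' v' hu hv => ?_, ?_⟩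
  · -- every vector of `𝔫` is in the range of `frameOp`
    obtain ⟨w, hw⟩ : ∃ w, (u : L) = frameOp Q f J μ w := by
      refine ⟨∑ a ∈ J, ((μ a)⁻¹ * Q.form u (f a)) • f a, ?_⟩
      rw [map_sum, ← hd.expand u u.2]
      refine Finset.sum_congr rfl fun a ha => ?_
      rw [hd.expand u u.2, map_smul, frameOp_apply, Finset.sum_eq_single_of_mem a ha, hF.norm,
        smul_smul, mul_one]
      · congr 1
        have := (hF.pos a ha).ne'
        field_simp
      · intro b _ hba
        rw [hF.ortho hba]; simp
    have hw' : (u' : L) = frameOp Q f J μ (ρ x w) := by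
      rw [frameOp_comm hρ hF.invariant, ← hw, hu]
    rw [hd.form_of_eq_frameOp hw', hd.form_of_eq_frameOp hw, ← hv, hρ]
  · rw [← hF.trace, ← hd.tr_eq]
    congr 1
    funext x
    exact (hT (Submodule.inclusion (ominus_le_ominus_top Q _ _) x)
      (Submodule.inclusion (ominus_le_ominus_top Q _ _) x)).symm

end PairOfFrame

/-! ### Convergence of frames -/

section Convergence
variable {V : Type*} [AddCommGroup V] [Module ℝ V] {κ : Type*} {l : Filter κ}

/-- Convergence of vectors in a finite-dimensional space without a chosen topology: every linear
functional converges. -/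
def LinTendsto (u : κ → V) (l : Filter κ) (x : V) : Prop :=
  ∀ φ : V →ₗ[ℝ] ℝ, Tendsto (fun k => φ (u k)) l (𝓝 (φ x))

theorem LinTendsto.bilinear [FiniteDimensional ℝ V] {u v : κ → V} {x y : V}
    (hu : LinTendsto u l x) (hv : LinTendsto v l y)
    (β : LinearMap.BilinForm ℝ V) : Tendsto (fun k => β (u k) (v k)) l (𝓝 (β x y)) := by
  have h : ∀ u v : V, β u v = ∑ i, (Module.finBasis ℝ V).coord i u * β (Module.finBasis ℝ V i) v := by
    intro u v
    conv_lhs => rw [← (Module.finBasis ℝ V).sum_repr u]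
    simp only [map_sum, LinearMap.sum_apply, map_smul, LinearMap.smul_apply, smul_eq_mul,
      Module.Basis.coord_apply]
  refine (tendsto_congr fun k => h _ _).2 ?_
  rw [h x y]
  exact tendsto_finsetSum _ fun i _ => (hu _).mul (hv _)

theorem exists_tendsto_of_mem_Icc {𝓤 : Ultrafilter κ} {u : κ → ℝ} {a b : ℝ}
    (hu : ∀ k, u k ∈ Set.Icc a b) : ∃ t, Tendsto u 𝓤 (𝓝 t) := by
  obtain ⟨t, -, ht⟩ := (isCompact_Icc (a := a) (b := b)).ultrafilter_le_nhds (𝓤.map u)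
    (le_principal_iff.2 (Filter.mem_map.2 (Eventually.of_forall hu)))
  exact ⟨t, ht⟩

theorem ScalarProduct.exists_linTendsto [FiniteDimensional ℝ V] (X : ScalarProduct V)
    (𝓤 : Ultrafilter κ) {u : κ → V} (hu : ∀ k, X.form (u k) (u k) = 1) :
    ∃ x, LinTendsto u 𝓤 x := by
  have h1 : ∀ i, ∃ t : ℝ, Tendsto (fun k => X.form (u k) (X.onb i)) 𝓤 (𝓝 t) := fun i => by
    have hb : ∀ k, X.form (u k) (X.onb i) ∈ Set.Icc (-1 : ℝ) 1 := fun k => by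
      have h := X.form_self_nonneg (u k - X.form (u k) (X.onb i) • X.onb i)
      have h1 := X.form_onb i i
      have h2 := X.symm (X.onb i) (u k)
      simp only [map_sub, map_smul, LinearMap.sub_apply, LinearMap.smul_apply, smul_eq_mul, h2] at h
      rw [h1, hu] at h
      simp at h
      exact abs_le.1 ((sq_le_one_iff_abs_le_one _).1 (by nlinarith))
    exact exists_tendsto_of_mem_Icc hb
  choose t ht using h1
  refine ⟨∑ i, t i • X.onb i, fun φ => ?_⟩
  have h2 : ∀ k, φ (u k) = ∑ i, X.form (u k) (X.onb i) * φ (X.onb i) := fun k => by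
    conv_lhs => rw [← X.sum_form_smul_onb (u k)]
    simp
  simp only [h2, map_sum, map_smul, smul_eq_mul]
  exact tendsto_finsetSum _ fun i _ => (ht i).mul_const _

theorem LinTendsto.lie {L : Type*} [LieRing L] [LieAlgebra ℝ L] [FiniteDimensional ℝ L]
    {u v : κ → L} {x y : L} (hu : LinTendsto u l x) (hv : LinTendsto v l y) :
    LinTendsto (fun k => ⁅u k, v k⁆) l ⁅x, y⁆ := fun φ =>
  hu.bilinear hv ((LieModule.toEnd ℝ L L : L →ₗ[ℝ] Module.End ℝ L).compr₂ φ)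

theorem tendsto_structConst {L : Type*} [LieRing L] [LieAlgebra ℝ L] [FiniteDimensional ℝ L]
    {ι : Type*} (Q : ScalarProduct L) {u : κ → ι → L} {x : ι → L}
    (hu : ∀ a, LinTendsto (fun k => u k a) l (x a)) (a b c : ι) :
    Tendsto (fun k => structConst Q (u k) a b c) l (𝓝 (structConst Q x a b c)) :=
  ((hu a).lie (hu b)).bilinear (hu c) Q.form

end Convergence

section Estimate
variable {ι : Type*} [DecidableEq ι]

/-- If `t²` is symmetric in its indices, then in the sum of `μ a μ b t² / μ c` over `P ∪ N` the
terms with `c` and exactly one of `a`, `b` in `N` contribute at least `2 ∑ μ a t²`: symmetrize in the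
two indices from `N` and use `μ b / μ c + μ c / μ b ≥ 2`. -/
theorem sum_div_ge {t : ι → ι → ι → ℝ} (h1 : ∀ a b c, t a b c ^ 2 = t b a c ^ 2)
    (h2 : ∀ a b c, t a b c ^ 2 = t a c b ^ 2) {P N : Finset ι} (hPN : Disjoint P N) {μ : ι → ℝ}
    (hP : ∀ a ∈ P, 0 < μ a) (hN : ∀ a ∈ N, 0 < μ a) :
    ∑ a ∈ P, ∑ b ∈ P, ∑ c ∈ P, μ a * μ b * t a b c ^ 2 / μ c
      + 2 * ∑ a ∈ P, ∑ b ∈ N, ∑ c ∈ N, μ a * t a b c ^ 2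
    ≤ ∑ a ∈ P ∪ N, ∑ b ∈ P ∪ N, ∑ c ∈ P ∪ N, μ a * μ b * t a b c ^ 2 / μ c := by
  set g : ι → ι → ι → ℝ := fun a b c => μ a * μ b * t a b c ^ 2 / μ c with hg
  have hpos : ∀ a ∈ P ∪ N, 0 < μ a := fun a ha =>
    (Finset.mem_union.1 ha).elim (hP a) (hN a)
  have hg0 : ∀ A B C : Finset ι, A ⊆ P ∪ N → B ⊆ P ∪ N → C ⊆ P ∪ N →
      0 ≤ ∑ a ∈ A, ∑ b ∈ B, ∑ c ∈ C, g a b c := fun A B C hA hB hC =>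
    Finset.sum_nonneg fun a ha => Finset.sum_nonneg fun b hb => Finset.sum_nonneg fun c hc =>
      div_nonneg (mul_nonneg (mul_nonneg (hpos a (hA ha)).le (hpos b (hB hb)).le) (sq_nonneg _))
        (hpos c (hC hc)).le
  have hPs : P ⊆ P ∪ N := Finset.subset_union_left
  have hNs : N ⊆ P ∪ N := Finset.subset_union_right
  have hsplit : ∑ a ∈ P ∪ N, ∑ b ∈ P ∪ N, ∑ c ∈ P ∪ N, g a b c =
      (∑ a ∈ P, ∑ b ∈ P, ∑ c ∈ P, g a b c) + (∑ a ∈ P, ∑ b ∈ P, ∑ c ∈ N, g a b c)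
      + (∑ a ∈ P, ∑ b ∈ N, ∑ c ∈ P, g a b c) + (∑ a ∈ P, ∑ b ∈ N, ∑ c ∈ N, g a b c)
      + (∑ a ∈ N, ∑ b ∈ P, ∑ c ∈ P, g a b c) + (∑ a ∈ N, ∑ b ∈ P, ∑ c ∈ N, g a b c)
      + (∑ a ∈ N, ∑ b ∈ N, ∑ c ∈ P, g a b c) + (∑ a ∈ N, ∑ b ∈ N, ∑ c ∈ N, g a b c) := by
    simp only [Finset.sum_union hPN, Finset.sum_add_distrib]
    ring
  have hswap : ∑ a ∈ N, ∑ b ∈ P, ∑ c ∈ N, g a b c = ∑ a ∈ P, ∑ b ∈ N, ∑ c ∈ N, g a b c := by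
    rw [Finset.sum_comm]
    refine Finset.sum_congr rfl fun a _ => Finset.sum_congr rfl fun b _ =>
      Finset.sum_congr rfl fun c _ => ?_
    simp only [hg, h1 b a c, mul_comm (μ b) (μ a)]
  have hamgm : ∑ a ∈ P, ∑ b ∈ N, ∑ c ∈ N, μ a * t a b c ^ 2
      ≤ ∑ a ∈ P, ∑ b ∈ N, ∑ c ∈ N, g a b c := by
    refine Finset.sum_le_sum fun a ha => ?_
    have hsym : ∑ b ∈ N, ∑ c ∈ N, g a b c = ∑ b ∈ N, ∑ c ∈ N, g a c b := Finset.sum_comm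
    have hle : ∑ b ∈ N, ∑ c ∈ N, 2 * (μ a * t a b c ^ 2)
        ≤ ∑ b ∈ N, ∑ c ∈ N, (g a b c + g a c b) := by
      refine Finset.sum_le_sum fun b hb => Finset.sum_le_sum fun c hc => ?_
      have hb' := hN b hb
      have hc' := hN c hc
      have ha' := hP a ha
      have hkey : 2 ≤ μ b / μ c + μ c / μ b := by
        rw [div_add_div _ _ hc'.ne' hb'.ne', le_div_iff₀ (mul_pos hc' hb')]
        nlinarith [sq_nonneg (μ b - μ c)]
      have heq : g a b c + g a c b = (μ b / μ c + μ c / μ b) * (μ a * t a b c ^ 2) := by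
        simp only [hg, ← h2 a b c]
        ring
      rw [heq]
      exact mul_le_mul_of_nonneg_right hkey (by positivity)
    simp only [Finset.sum_add_distrib, ← Finset.mul_sum] at hle ⊢
    linarith
  rw [hsplit, hswap]
  have e1 := hg0 P P N hPs hPs hNs
  have e2 := hg0 P N P hPs hNs hPs
  have e3 := hg0 N P P hNs hPs hPs
  have e4 := hg0 N N P hNs hNs hPs
  have e5 := hg0 N N N hNs hNs hNs
  linarith

end Estimate

section Compactness
variable {L : Type*} [LieRing L] [LieAlgebra ℝ L]
  {S : Type*} {ρ : S → L →ₗ[ℝ] L} {Q : ScalarProduct L} {𝔥 : LieSubalgebra ℝ L}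
  {T : ScalarProduct (mSpace Q 𝔥)} {T' : LinearMap.BilinForm ℝ L}

theorem structConst_sq_swap {ι : Type*} (f : ι → L) (a b c : ι) :
    structConst Q f a b c ^ 2 = structConst Q f b a c ^ 2 := by
  rw [structConst, structConst, ← lie_skew (f b), map_neg, LinearMap.neg_apply, neg_sq]

theorem structConst_sq_swap_right (had : ∀ x y z : L, Q.form ⁅x, y⁆ z = - Q.form y ⁅x, z⁆)
    {ι : Type*} (f : ι → L) (a b c : ι) :
    structConst Q f a b c ^ 2 = structConst Q f a c b ^ 2 := by
  rw [structConst, structConst, had, neg_sq, Q.symm]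

variable [FiniteDimensional ℝ L]

/-- The trace condition bounds the weights, uniformly over all frames. -/
theorem frame_weight_le (hT : ∀ u v : mSpace Q 𝔥, T' u v = T.form u v) :
    ∃ C : ℝ, 0 ≤ C ∧ ∀ f J K μ, IsFrame ρ Q 𝔥 T' f J K μ → ∀ a, μ a ∈ Set.Icc 0 C := by
  obtain ⟨C, hC0, hC⟩ := T.exists_form_le (Q.restrict (mSpace Q 𝔥)).form
  refine ⟨C, hC0, fun f J K μ hF a => ?_⟩
  by_cases ha : a ∈ J
  swap
  · rw [hF.zero a ha]; exact ⟨le_rfl, hC0⟩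
  have hm : ∀ b ∈ J, f b ∈ mSpace Q 𝔥 := fun b hb =>
    mem_ominus.2 ⟨trivial, fun w hw => hF.perp b (Or.inl hb) w hw⟩
  have hTb : ∀ b ∈ J, 0 ≤ μ b * T' (f b) (f b) := fun b hb => by
    rw [hT ⟨f b, hm b hb⟩ ⟨f b, hm b hb⟩]
    exact mul_nonneg (hF.pos b hb).le (T.form_self_nonneg _)
  have h1 : μ a * T' (f a) (f a) ≤ 1 := by
    rw [← hF.trace]
    exact Finset.single_le_sum hTb ha
  have h2 : 1 ≤ C * T' (f a) (f a) := by
    rw [hT ⟨f a, hm a ha⟩ ⟨f a, hm a ha⟩, ← hF.norm a]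
    exact hC ⟨f a, hm a ha⟩
  have h3 := hF.pos a ha
  refine ⟨h3.le, ?_⟩
  nlinarith

/-- The range of an equivariant operator `frameOp` with positive weights is invariant. -/
theorem invariantSubspace_span (hρ : ∀ x u v, Q.form (ρ x u) (ρ x v) = Q.form u v) {ι : Type*}
    [DecidableEq ι]
    {f : ι → L} (hf : ∀ a b, Q.form (f a) (f b) = if a = b then 1 else 0)
    {J : Finset ι} {μ : ι → ℝ} (hpos : ∀ a ∈ J, 0 < μ a)
    (hinv : ∀ x u v, ∑ a ∈ J, μ a * (Q.form (f a) (ρ x u) * Q.form (f a) (ρ x v))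
      = ∑ a ∈ J, μ a * (Q.form (f a) u * Q.form (f a) v)) :
    InvariantSubspace ρ (Submodule.span ℝ (f '' J)) := by
  have hA : ∀ w, frameOp Q f J μ w ∈ Submodule.span ℝ (f '' J) := fun w => by
    rw [frameOp_apply]
    exact Submodule.sum_mem _ fun a ha => Submodule.smul_mem _ _
      (Submodule.subset_span ⟨a, ha, rfl⟩)
  intro x v hv
  induction hv using Submodule.span_induction with
  | mem v hv =>
    obtain ⟨a, ha, rfl⟩ := hv
    have h1 : f a = frameOp Q f J μ ((μ a)⁻¹ • f a) := by
      rw [map_smul, frameOp_apply, Finset.sum_eq_single_of_mem a ha]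
      · rw [hf, if_pos rfl, mul_one, smul_smul, inv_mul_cancel₀ (hpos a ha).ne', one_smul]
      · intro b _ hba
        rw [hf, if_neg hba]; simp
    rw [h1, ← frameOp_comm hρ hinv]
    exact hA _
  | zero => simp
  | add u v _ _ hu hv => rw [map_add]; exact Submodule.add_mem _ hu hv
  | smul c v _ hv => rw [map_smul]; exact Submodule.smul_mem _ _ hv

/-- A limit of frames is a frame for a possibly smaller subalgebra, with `𝔫'` spanned by
the vectors of positive limit weight; the functional does not drop in the limit. -/
theorem exists_limit_frame (hρ : ∀ x u v, Q.form (ρ x u) (ρ x v) = Q.form u v)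
    (had : ∀ x y z : L, Q.form ⁅x, y⁆ z = - Q.form y ⁅x, z⁆)
    (hder : ∀ W : Submodule ℝ L, InvariantSubspace ρ W → ∀ ξ ∈ 𝔥, ∀ w ∈ W, ⁅ξ, w⁆ ∈ W)
    {f : ℕ → Fin (Module.finrank ℝ L) → L}
    {J K : Finset (Fin (Module.finrank ℝ L))} {μ : ℕ → Fin (Module.finrank ℝ L) → ℝ}
    {f₀ : Fin (Module.finrank ℝ L) → L} {μ₀ : Fin (Module.finrank ℝ L) → ℝ}
    {l : Filter ℕ} [l.NeBot] (hF : ∀ᶠ k in l, IsFrame ρ Q 𝔥 T' (f k) J K (μ k))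
    (hf : ∀ a, LinTendsto (fun k => f k a) l (f₀ a))
    (hμ : ∀ a, Tendsto (fun k => μ k a) l (𝓝 (μ₀ a))) {s : ℝ}
    (hs : Tendsto (fun k => frameS Q (f k) J K (μ k)) l (𝓝 s)) :
    ∃ J' K', IsFrame ρ Q 𝔥 T' f₀ J' K' μ₀ ∧ s ≤ frameS Q f₀ J' K' μ₀ := by
  have hμ0 : ∀ a, 0 ≤ μ₀ a := fun a => ge_of_tendsto (hμ a) (hF.mono fun k hk => by
    by_cases ha : a ∈ J
    · exact (hk.pos a ha).le
    · exact (hk.zero a ha).ge)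
  have hμz : ∀ a, a ∉ J → μ₀ a = 0 := fun a ha =>
    tendsto_nhds_unique (hμ a) (tendsto_const_nhds.congr' (hF.mono fun k hk => (hk.zero a ha).symm))
  set P := J.filter fun a => 0 < μ₀ a with hP
  set N := J.filter fun a => ¬ 0 < μ₀ a with hN
  have mP : ∀ a, a ∈ P ↔ a ∈ J ∧ 0 < μ₀ a := fun a => by simp [hP]
  have mN : ∀ a, a ∈ N ↔ a ∈ J ∧ ¬ 0 < μ₀ a := fun a => by simp [hN]
  have hPN : Disjoint P N := Finset.disjoint_filter_filter_not _ _ _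
  have hJ : P ∪ N = J := Finset.filter_union_filter_not_eq _ _
  have hPpos : ∀ a ∈ P, 0 < μ₀ a := fun a ha => ((mP a).1 ha).2
  have hPz : ∀ a, a ∉ P → μ₀ a = 0 := fun a ha => by
    by_cases haJ : a ∈ J
    · exact le_antisymm (not_lt.1 fun h => ha ((mP a).2 ⟨haJ, h⟩)) (hμ0 a)
    · exact hμz a haJ
  have hPJ : P ⊆ J := Finset.filter_subset _ _
  have hsum : ∀ g : Fin (Module.finrank ℝ L) → ℝ, (∀ a ∉ P, g a = 0) →
      ∑ a ∈ J, g a = ∑ a ∈ P, g a := fun g hg =>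
    (Finset.sum_subset hPJ fun a _ ha => hg a ha).symm
  have hbil : ∀ a b, ∀ β : LinearMap.BilinForm ℝ L,
      Tendsto (fun k => β (f k a) (f k b)) l (𝓝 (β (f₀ a) (f₀ b))) := fun a b β =>
    (hf a).bilinear (hf b) β
  have ht := tendsto_structConst Q hf
  have hortho : ∀ a b, Q.form (f₀ a) (f₀ b) = if a = b then 1 else 0 := fun a b =>
    tendsto_nhds_unique (hbil a b Q.form)
      (tendsto_const_nhds.congr' (hF.mono fun k hk => (hk.orthonormal a b).symm))
  have hmem : ∀ a, a ∉ J → a ∉ K → f₀ a ∈ 𝔥 := fun a ha hb => by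
    have h1 : f₀ a ∈ 𝔥.toSubmodule := by
      rw [← Subspace.forall_mem_dualAnnihilator_apply_eq_zero_iff]
      intro φ hφ
      rw [Submodule.mem_dualAnnihilator] at hφ
      exact tendsto_nhds_unique (hf a φ) (tendsto_const_nhds.congr'
        (hF.mono fun k hk => (hφ _ (hk.mem a ha hb)).symm))
    exact h1
  have hperp : ∀ a, a ∈ J ∨ a ∈ K → ∀ x ∈ 𝔥, Q.form x (f₀ a) = 0 := fun a ha x hx =>
    tendsto_nhds_unique (hf a (Q.form x)) (tendsto_const_nhds.congr'
      (hF.mono fun k hk => (hk.perp a ha x hx).symm))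
  have hclosed : ∀ a b c, a ∉ K → b ∉ K → c ∈ K → structConst Q f₀ a b c = 0 :=
    fun a b c ha hb hc => tendsto_nhds_unique (ht a b c) (tendsto_const_nhds.congr'
      (hF.mono fun k hk => (hk.closed a b c ha hb hc).symm))
  have htrace : ∑ a ∈ P, μ₀ a * T' (f₀ a) (f₀ a) = 1 := by
    rw [← hsum _ fun a ha => by rw [hPz a ha, zero_mul]]
    exact tendsto_nhds_unique (tendsto_finsetSum _ fun a _ => (hμ a).mul (hbil a a T'))
      (tendsto_const_nhds.congr' (hF.mono fun k hk => hk.trace.symm))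
  have hinv : ∀ x u v, ∑ a ∈ P, μ₀ a * (Q.form (f₀ a) (ρ x u) * Q.form (f₀ a) (ρ x v))
      = ∑ a ∈ P, μ₀ a * (Q.form (f₀ a) u * Q.form (f₀ a) v) := fun x u v => by
    rw [← hsum _ fun a ha => by rw [hPz a ha, zero_mul],
      ← hsum _ fun a ha => by rw [hPz a ha, zero_mul]]
    have hlin : ∀ u v, Tendsto (fun k => ∑ a ∈ J, μ k a * (Q.form (f k a) u * Q.form (f k a) v)) l
        (𝓝 (∑ a ∈ J, μ₀ a * (Q.form (f₀ a) u * Q.form (f₀ a) v))) := fun u v =>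
      tendsto_finsetSum _ fun a _ => (hμ a).mul
        ((hf a (LinearMap.flip Q.form u)).mul (hf a (LinearMap.flip Q.form v)))
    exact tendsto_nhds_unique (hlin _ _)
      ((hlin u v).congr' (hF.mono fun k hk => (hk.invariant x u v).symm))
  -- the terms of the functional which converge
  set A : ℕ → ℝ := fun k => -(1 / 2) * ∑ a ∈ J, μ k a * killingForm ℝ L (f k a) (f k a)
    - (1 / 2) * ∑ a ∈ J, ∑ b ∈ K, ∑ c ∈ K, μ k a * structConst Q (f k) a b c ^ 2 with hA
  set A₀ : ℝ := -(1 / 2) * ∑ a ∈ J, μ₀ a * killingForm ℝ L (f₀ a) (f₀ a)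
    - (1 / 2) * ∑ a ∈ J, ∑ b ∈ K, ∑ c ∈ K, μ₀ a * structConst Q f₀ a b c ^ 2 with hA₀
  have hAt : Tendsto A l (𝓝 A₀) :=
    ((tendsto_finsetSum _ fun a _ => (hμ a).mul (hbil a a _)).const_mul _).sub
      ((tendsto_finsetSum _ fun a _ => tendsto_finsetSum _ fun b _ => tendsto_finsetSum _
        fun c _ => (hμ a).mul ((ht a b c).pow 2)).const_mul _)
  have hD : Tendsto (fun k => 4 * (A k - frameS Q (f k) J K (μ k))) l (𝓝 (4 * (A₀ - s))) :=
    (hAt.sub hs).const_mul 4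
  have hDk : ∀ k, 4 * (A k - frameS Q (f k) J K (μ k)) =
      ∑ a ∈ J, ∑ b ∈ J, ∑ c ∈ J, μ k a * μ k b * structConst Q (f k) a b c ^ 2 / μ k c := fun k => by
    simp only [hA, frameS]; ring
  -- the cubic term stays bounded, which forces `[𝔫', 𝔫'] ⊂ 𝔥 + 𝔫'` for the limit `𝔫'`
  have hPPN : ∀ a ∈ P, ∀ b ∈ P, ∀ c ∈ N, structConst Q f₀ a b c = 0 := by
    intro a ha b hb c hc
    have hc0 : μ₀ c = 0 := hPz c fun h => ((mN c).1 hc).2 (hPpos c h)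
    have hcJ : c ∈ J := ((mN c).1 hc).1
    have hle : ∀ᶠ k in l, μ k a * μ k b * structConst Q (f k) a b c ^ 2
        ≤ 4 * (A k - frameS Q (f k) J K (μ k)) * μ k c := by
      filter_upwards [hF] with k hk
      rw [hDk, ← div_le_iff₀ (hk.pos c hcJ)]
      have h0 : ∀ a ∈ J, ∀ b ∈ J, ∀ c ∈ J,
          0 ≤ μ k a * μ k b * structConst Q (f k) a b c ^ 2 / μ k c := fun a ha b hb c hc =>
        div_nonneg (mul_nonneg (mul_nonneg (hk.pos a ha).le (hk.pos b hb).le) (sq_nonneg _))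
          (hk.pos c hc).le
      refine (Finset.single_le_sum (h0 a (hPJ ha) b (hPJ hb)) hcJ).trans ?_
      refine (Finset.single_le_sum (f := fun b => ∑ c ∈ J, μ k a * μ k b * structConst Q (f k) a b c ^ 2 / μ k c)
        (fun b hb => Finset.sum_nonneg (h0 a (hPJ ha) b hb)) (hPJ hb)).trans ?_
      exact Finset.single_le_sum (f := fun a => ∑ b ∈ J, ∑ c ∈ J, μ k a * μ k b * structConst Q (f k) a b c ^ 2 / μ k c)
        (fun a ha => Finset.sum_nonneg fun b hb => Finset.sum_nonneg (h0 a ha b hb)) (hPJ ha)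
    have hlim := le_of_tendsto_of_tendsto (((hμ a).mul (hμ b)).mul ((ht a b c).pow 2))
      (hD.mul (hμ c)) hle
    rw [hc0, mul_zero] at hlim
    have h1 := mul_pos (hPpos a ha) (hPpos b hb)
    exact pow_eq_zero_iff (two_ne_zero) |>.1
      (le_antisymm (nonpos_of_mul_nonpos_right hlim h1) (sq_nonneg _))
  have hspan := hder _ (invariantSubspace_span hρ hortho hPpos hinv)
  have hHP : ∀ a b c, f₀ a ∈ 𝔥 → b ∈ P → c ∉ P → structConst Q f₀ a b c = 0 := by
    intro a b c ha hb hc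
    have h1 := hspan _ ha (f₀ b) (Submodule.subset_span ⟨b, hb, rfl⟩)
    rw [structConst]
    generalize ⁅f₀ a, f₀ b⁆ = y at h1
    induction h1 using Submodule.span_induction with
    | mem v hv =>
      obtain ⟨d, hd, rfl⟩ := hv
      rw [hortho, if_neg (ne_of_mem_of_not_mem hd hc)]
    | zero => simp
    | add u v _ _ hu hv => rw [map_add, LinearMap.add_apply, hu, hv, add_zero]
    | smul r v _ hv => rw [map_smul, LinearMap.smul_apply, hv, smul_zero]
  have hdisj : ∀ a ∈ J, a ∉ K := by
    obtain ⟨k, hk⟩ := hF.exists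
    exact hk.disjoint
  have hKne : K.Nonempty := by
    obtain ⟨k, hk⟩ := hF.exists
    exact hk.nonempty
  have hfr : IsFrame ρ Q 𝔥 T' f₀ P (K ∪ N) μ₀ :=
    { orthonormal := hortho
      disjoint := fun a ha hb => (Finset.mem_union.1 hb).elim (hdisj a (hPJ ha))
        (fun h => ((mN a).1 h).2 (hPpos a ha))
      mem := fun a ha hb => hmem a
        (fun h => by
          rw [← hJ] at h
          exact (Finset.mem_union.1 h).elim ha fun h => hb (Finset.mem_union_right _ h))
        (fun h => hb (Finset.mem_union_left _ h))
      perp := fun a ha => hperp a (ha.elim (fun h => Or.inl (hPJ h)) fun h =>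
        (Finset.mem_union.1 h).elim Or.inr fun h => Or.inl ((mN a).1 h).1)
      pos := hPpos
      zero := hPz
      nonempty := hKne.mono Finset.subset_union_left
      closed := by
        intro a b c ha hb hc
        rw [Finset.mem_union, not_or] at ha hb
        rcases Finset.mem_union.1 hc with hc | hc
        · exact hclosed a b c ha.1 hb.1 hc
        have hcP : c ∉ P := fun h => ((mN c).1 hc).2 (hPpos c h)
        have hh : ∀ a, a ∉ K → a ∉ N → a ∉ P → f₀ a ∈ 𝔥 := fun a h1 h2 h3 => hmem a (fun h => by
          rw [← hJ] at h
          exact (Finset.mem_union.1 h).elim h3 h2) h1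
        by_cases haP : a ∈ P
        · by_cases hbP : b ∈ P
          · exact hPPN a haP b hbP c hc
          · have h1 := hHP b a c (hh b hb.1 hb.2 hbP) haP hcP
            have h2 := structConst_sq_swap (Q := Q) f₀ a b c
            rw [h1, zero_pow two_ne_zero] at h2
            exact pow_eq_zero_iff two_ne_zero |>.1 h2
        · by_cases hbP : b ∈ P
          · exact hHP a b c (hh a ha.1 ha.2 haP) hbP hcP
          · exact hperp c (Or.inl ((mN c).1 hc).1) _
              (𝔥.lie_mem (hh a ha.1 ha.2 haP) (hh b hb.1 hb.2 hbP))
      trace := htrace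
      invariant := hinv }
  refine ⟨P, K ∪ N, hfr, ?_⟩
  have hR : Tendsto (fun k => A k
      - (1 / 4) * ∑ a ∈ P, ∑ b ∈ P, ∑ c ∈ P, μ k a * μ k b * structConst Q (f k) a b c ^ 2 / μ k c
      - (1 / 2) * ∑ a ∈ P, ∑ b ∈ N, ∑ c ∈ N, μ k a * structConst Q (f k) a b c ^ 2) l
      (𝓝 (A₀
      - (1 / 4) * ∑ a ∈ P, ∑ b ∈ P, ∑ c ∈ P, μ₀ a * μ₀ b * structConst Q f₀ a b c ^ 2 / μ₀ c
      - (1 / 2) * ∑ a ∈ P, ∑ b ∈ N, ∑ c ∈ N, μ₀ a * structConst Q f₀ a b c ^ 2)) :=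
    (hAt.sub ((tendsto_finsetSum _ fun a _ => tendsto_finsetSum _ fun b _ => tendsto_finsetSum _
        fun c hc => (((hμ a).mul (hμ b)).mul ((ht a b c).pow 2)).div (hμ c)
          (hPpos c hc).ne').const_mul _)).sub
      ((tendsto_finsetSum _ fun a _ => tendsto_finsetSum _ fun b _ => tendsto_finsetSum _
        fun c _ => (hμ a).mul ((ht a b c).pow 2)).const_mul _)
  have hle : ∀ᶠ k in l, frameS Q (f k) J K (μ k) ≤ A k
      - (1 / 4) * ∑ a ∈ P, ∑ b ∈ P, ∑ c ∈ P, μ k a * μ k b * structConst Q (f k) a b c ^ 2 / μ k c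
      - (1 / 2) * ∑ a ∈ P, ∑ b ∈ N, ∑ c ∈ N, μ k a * structConst Q (f k) a b c ^ 2 := by
    filter_upwards [hF] with k hk
    have h1 := sum_div_ge (t := structConst Q (f k)) (structConst_sq_swap (f k))
      (structConst_sq_swap_right had (f k)) hPN (μ := μ k)
      (fun a ha => hk.pos a (hPJ ha)) (fun a ha => hk.pos a ((mN a).1 ha).1)
    rw [hJ, ← hDk] at h1
    linarith
  refine (le_of_tendsto_of_tendsto hs hR hle).trans (le_of_eq ?_)
  have hKN : Disjoint K N := Finset.disjoint_left.2 fun a ha hb => hdisj a ((mN a).1 hb).1 ha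
  -- the mixed terms vanish since `𝔨` is a subalgebra and `ad` is skew
  have hcross : ∀ a ∈ P, ∑ b ∈ K ∪ N, ∑ c ∈ K ∪ N, μ₀ a * structConst Q f₀ a b c ^ 2
      = ∑ b ∈ K, ∑ c ∈ K, μ₀ a * structConst Q f₀ a b c ^ 2
        + ∑ b ∈ N, ∑ c ∈ N, μ₀ a * structConst Q f₀ a b c ^ 2 := by
    intro a ha
    have h1 : ∀ b ∈ N, ∀ c ∈ K, structConst Q f₀ a b c ^ 2 = 0 := fun b hb c hc => by
      rw [hclosed a b c (hdisj a (hPJ ha)) (hdisj b ((mN b).1 hb).1) hc, zero_pow two_ne_zero]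
    have h2 : ∑ b ∈ K, ∑ c ∈ N, μ₀ a * structConst Q f₀ a b c ^ 2 = 0 :=
      Finset.sum_eq_zero fun b hb => Finset.sum_eq_zero fun c hc => by
        rw [structConst_sq_swap_right had, h1 c hc b hb, mul_zero]
    have h3 : ∑ b ∈ N, ∑ c ∈ K, μ₀ a * structConst Q f₀ a b c ^ 2 = 0 :=
      Finset.sum_eq_zero fun b hb => Finset.sum_eq_zero fun c hc => by
        rw [h1 b hb c hc, mul_zero]
    simp only [Finset.sum_union hKN, Finset.sum_add_distrib, h2, h3]
    ring
  rw [frameS, Finset.sum_congr rfl hcross, Finset.sum_add_distrib, hA₀,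
    hsum _ (fun a ha => by rw [hPz a ha, zero_mul]),
    hsum _ (fun a ha => Finset.sum_eq_zero fun b _ => Finset.sum_eq_zero fun c _ => by
      rw [hPz a ha, zero_mul])]
  ring

end Compactness

/-! ### Existence of a maximum -/

section Existence
variable {L : Type*} [LieRing L] [LieAlgebra ℝ L] [FiniteDimensional ℝ L]
  {S : Type*} {ρ : S → L →ₗ[ℝ] L} {Q : ScalarProduct L} {𝔥 : LieSubalgebra ℝ L}
  {T : ScalarProduct (mSpace Q 𝔥)} {T' : LinearMap.BilinForm ℝ L}

theorem ScalarProduct.tr_of_form_eq_smul {V : Type*} [AddCommGroup V] [Module ℝ V]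
    [FiniteDimensional ℝ V] {X Y : ScalarProduct V} {c : ℝ} (hc : c ≠ 0)
    (hXY : ∀ u v, X.form u v = c * Y.form u v) (β : LinearMap.BilinForm ℝ V) :
    X.tr (fun v => β v v) = c⁻¹ * Y.tr (fun v => β v v) := by
  have h1 : ∀ v, β v v = ∑ j, Y.form v (Y.onb j) * β (Y.onb j) v := fun v => by
    have h := congrArg (fun z => β z v) (Y.sum_form_smul_onb v)
    simp only [map_sum, LinearMap.sum_apply, map_smul, LinearMap.smul_apply, smul_eq_mul] at h
    exact h.symm
  rw [ScalarProduct.tr, Finset.sum_congr rfl fun i _ => h1 (X.onb i), Finset.sum_comm,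
    ScalarProduct.tr, Finset.mul_sum]
  refine Finset.sum_congr rfl fun j _ => ?_
  have h := congrArg (fun z => β (Y.onb j) z) (X.sum_form_smul_onb (Y.onb j))
  simp only [map_sum, map_smul, smul_eq_mul] at h
  rw [← h, Finset.mul_sum]
  refine Finset.sum_congr rfl fun i _ => ?_
  rw [hXY, Y.symm]
  field_simp

/-- A multiple of `Q` lies in `𝓜_T(𝔨)`. -/
theorem MT_nonempty (hρ : ∀ x u v, Q.form (ρ x u) (ρ x v) = Q.form u v)
    {𝔨 : LieSubalgebra ℝ L} (hlt : 𝔥 < 𝔨) : (MT ρ Q 𝔥 T 𝔨).Nonempty := by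
  set Y := Q.restrict (nSpace Q 𝔥 𝔨)
  set ι := Submodule.inclusion (ominus_le_ominus_top Q 𝔨.toSubmodule 𝔥.toSubmodule)
  set c := Y.tr fun x => T.form (ι x) (ι x) with hc
  have hne : Nontrivial (nSpace Q 𝔥 𝔨) := by
    obtain ⟨x, hx, hx'⟩ := SetLike.exists_of_lt hlt
    have hP := Q.orthProj_mem 𝔥.toSubmodule x
    have hm : x - Q.orthProj 𝔥.toSubmodule x ∈ nSpace Q 𝔥 𝔨 := by
      refine mem_ominus.2 ⟨𝔨.toSubmodule.sub_mem hx (hlt.le hP), fun w hw => ?_⟩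
      rw [Q.symm, map_sub, LinearMap.sub_apply, Q.form_orthProj _ _ hw, sub_self]
    refine ⟨⟨_, hm⟩, 0, fun h => hx' ?_⟩
    have h1 := sub_eq_zero.1 (congrArg Subtype.val h)
    rw [h1]
    exact hP
  have hpos : 0 < c := by
    have : Nonempty (Fin (Module.finrank ℝ (nSpace Q 𝔥 𝔨))) :=
      Fin.pos_iff_nonempty.1 Module.finrank_pos
    refine Finset.sum_pos (fun i _ => T.pos _ fun h => ?_) Finset.univ_nonempty
    exact Y.onb.ne_zero i (Submodule.inclusion_injective _ (h.trans (map_zero _).symm))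
  let X : ScalarProduct (nSpace Q 𝔥 𝔨) :=
    { form := c • Y.form
      symm := fun u v => by simp [Y.symm u v]
      pos := fun v hv => mul_pos hpos (Y.pos v hv) }
  have hXY : ∀ u v, X.form u v = c * Y.form u v := fun u v => rfl
  refine ⟨X, fun x u v u' v' hu hv => ?_, ?_⟩
  · rw [hXY, hXY]
    have h1 : Q.form u' v' = Q.form u v := by rw [← hu, ← hv, hρ]
    exact congrArg (c * ·) h1
  · exact (ScalarProduct.tr_of_form_eq_smul hpos.ne' hXY (T.form.compl₁₂ ι ι)).trans
      (inv_mul_cancel₀ hpos.ne')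

/-- Among all frames the functional attains its supremum. -/
theorem exists_max_frame (hρ : ∀ x u v, Q.form (ρ x u) (ρ x v) = Q.form u v)
    (had : ∀ x y z : L, Q.form ⁅x, y⁆ z = - Q.form y ⁅x, z⁆)
    (hder : ∀ W : Submodule ℝ L, InvariantSubspace ρ W → ∀ ξ ∈ 𝔥, ∀ w ∈ W, ⁅ξ, w⁆ ∈ W)
    (hT : ∀ u v : mSpace Q 𝔥, T' u v = T.form u v)
    (hne : ∃ f J K μ, IsFrame ρ Q 𝔥 T' f J K μ) :
    ∃ f J K μ, IsFrame ρ Q 𝔥 T' f J K μ ∧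
      ∀ f' J' K' μ', IsFrame ρ Q 𝔥 T' f' J' K' μ' → frameS Q f' J' K' μ' ≤ frameS Q f J K μ := by
  set 𝒮 : Set ℝ := {s | ∃ f J K μ, IsFrame ρ Q 𝔥 T' f J K μ ∧ frameS Q f J K μ = s} with h𝒮
  obtain ⟨C, hC0, hC⟩ := frame_weight_le (ρ := ρ) hT
  have hbdd : BddAbove 𝒮 := by
    obtain ⟨B, hB0, hB⟩ := Q.exists_form_le (-killingForm ℝ L)
    refine ⟨(1 / 2) * ∑ _a : Fin (Module.finrank ℝ L), C * B, ?_⟩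
    rintro _ ⟨f, J, K, μ, hF, rfl⟩
    have h1 : ∑ a ∈ J, - (μ a * killingForm ℝ L (f a) (f a)) ≤
        ∑ _a : Fin (Module.finrank ℝ L), C * B := by
      refine (Finset.sum_le_sum fun a _ => ?_).trans
        (Finset.sum_le_sum_of_subset_of_nonneg (Finset.subset_univ J) fun _ _ _ =>
          mul_nonneg hC0 hB0)
      have h2 := hB (f a)
      rw [hF.norm, mul_one] at h2
      have h3 := hC f J K μ hF a
      calc - (μ a * killingForm ℝ L (f a) (f a)) = μ a * (-killingForm ℝ L) (f a) (f a) := by simp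
        _ ≤ μ a * B := mul_le_mul_of_nonneg_left h2 h3.1
        _ ≤ C * B := mul_le_mul_of_nonneg_right h3.2 hB0
    have h2 : 0 ≤ ∑ a ∈ J, ∑ b ∈ K, ∑ c ∈ K, μ a * structConst Q f a b c ^ 2 :=
      Finset.sum_nonneg fun a _ => Finset.sum_nonneg fun b _ => Finset.sum_nonneg fun c _ =>
        mul_nonneg (hC f J K μ hF a).1 (sq_nonneg _)
    have h3 : 0 ≤ ∑ a ∈ J, ∑ b ∈ J, ∑ c ∈ J, μ a * μ b * structConst Q f a b c ^ 2 / μ c :=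
      Finset.sum_nonneg fun a _ => Finset.sum_nonneg fun b _ => Finset.sum_nonneg fun c _ =>
        div_nonneg (mul_nonneg (mul_nonneg (hC f J K μ hF a).1 (hC f J K μ hF b).1) (sq_nonneg _))
          (hC f J K μ hF c).1
    rw [Finset.sum_neg_distrib] at h1
    rw [frameS]
    linarith
  have h𝒮ne : 𝒮.Nonempty := by
    obtain ⟨f, J, K, μ, hF⟩ := hne
    exact ⟨_, f, J, K, μ, hF, rfl⟩
  obtain ⟨s, -, hs, hs𝒮⟩ := exists_seq_tendsto_sSup h𝒮ne hbdd
  choose f J K μ hF hfs using hs𝒮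
  -- along an ultrafilter the index sets are constant and all bounded quantities converge
  set 𝓤 : Ultrafilter ℕ := hyperfilter ℕ
  have hs' : Tendsto s 𝓤 (𝓝 (sSup 𝒮)) := hs.mono_left Nat.hyperfilter_le_atTop
  obtain ⟨⟨J₀, K₀⟩, hJK⟩ : ∃ p, ∀ᶠ k in (𝓤 : Filter ℕ), (J k, K k) = p := by
    obtain ⟨p, hp⟩ := (𝓤.map fun k => (J k, K k)).eq_pure_of_finite
    refine ⟨p, ?_⟩
    have h1 : ({p} : Set _) ∈ 𝓤.map fun k => (J k, K k) := by
      rw [hp]; exact Ultrafilter.mem_pure.2 rfl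
    exact h1
  have hJK' : ∀ᶠ k in (𝓤 : Filter ℕ), J k = J₀ ∧ K k = K₀ :=
    hJK.mono fun k hk => Prod.mk.inj hk
  choose f₀ hf₀ using fun a => Q.exists_linTendsto 𝓤 (u := fun k => f k a) fun k => (hF k).norm a
  choose μ₀ hμ₀ using fun a => exists_tendsto_of_mem_Icc (𝓤 := 𝓤) (u := fun k => μ k a)
    fun k => hC _ _ _ _ (hF k) a
  obtain ⟨J', K', hF', hle⟩ := exists_limit_frame (l := 𝓤) (f := f) (J := J₀) (K := K₀) (μ := μ)
    hρ had hder (hJK'.mono fun k hk => by rw [← hk.1, ← hk.2]; exact hF k) hf₀ hμ₀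
    (hs'.congr' (hJK'.mono fun k hk => by rw [← hk.1, ← hk.2]; exact (hfs k).symm))
  exact ⟨f₀, J', K', μ₀, hF', fun f J K μ h => (le_csSup hbdd ⟨f, J, K, μ, h, rfl⟩).trans hle⟩

/-- The algebraic form of the theorem, for a family of `Q`-isometries `ρ` compatible with `𝔥`. -/
theorem exists_isApical (hρ : ∀ x u v, Q.form (ρ x u) (ρ x v) = Q.form u v)
    (had : ∀ x y z : L, Q.form ⁅x, y⁆ z = - Q.form y ⁅x, z⁆)
    (hder : ∀ W : Submodule ℝ L, InvariantSubspace ρ W → ∀ ξ ∈ 𝔥, ∀ w ∈ W, ⁅ξ, w⁆ ∈ W)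
    (hinv : ∀ 𝔰 : LieSubalgebra ℝ L, 𝔥 ≤ 𝔰 → InvariantSubspace ρ 𝔰.toSubmodule)
    (htop : 𝔥 ≠ ⊤) (hmax : ¬ IsCoatom 𝔥) : ∃ 𝔨, IsApical ρ Q 𝔥 T 𝔨 := by
  obtain ⟨π, hπ⟩ := (mSpace Q 𝔥).subtype.exists_leftInverse_of_injective
    (Submodule.ker_subtype _)
  have hπ' : ∀ u : mSpace Q 𝔥, π u = u := fun u => LinearMap.congr_fun hπ u
  set T' : LinearMap.BilinForm ℝ L := T.form.compl₁₂ π π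
  have hT : ∀ u v : mSpace Q 𝔥, T' u v = T.form u v := fun u v => by
    simp only [T', LinearMap.compl₁₂_apply, hπ']
  have hframe : ∀ 𝔨 : LieSubalgebra ℝ L, 𝔥 < 𝔨 → 𝔨 ≠ ⊤ → ∀ h ∈ MT ρ Q 𝔥 T 𝔨,
      ∃ f J K μ, IsFrame ρ Q 𝔥 T' f J K μ ∧ frameS Q f J K μ = hatS Q 𝔥 𝔨 h :=
    fun 𝔨 hlt hne h hh => exists_isFrame hρ hT hlt hne (hinv _ le_rfl) (hinv _ hlt.le) hh
  have hne : ∃ f J K μ, IsFrame ρ Q 𝔥 T' f J K μ := by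
    obtain ⟨𝔨, hlt, hk⟩ : ∃ 𝔨, 𝔥 < 𝔨 ∧ 𝔨 ≠ ⊤ := by
      by_contra! h
      exact hmax ⟨htop, h⟩
    obtain ⟨h, hh⟩ := MT_nonempty (T := T) hρ hlt
    obtain ⟨f, J, K, μ, hF, -⟩ := hframe 𝔨 hlt hk h hh
    exact ⟨f, J, K, μ, hF⟩
  obtain ⟨f, J, K, μ, hF, hmaxF⟩ := exists_max_frame hρ had hder hT hne
  have hmem := hF.scalarProduct_mem_MT hρ hT
  have hle : ∀ 𝔨 : LieSubalgebra ℝ L, 𝔥 < 𝔨 → 𝔨 ≠ ⊤ →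
      sigma ρ Q 𝔥 T 𝔨 ≤ (hatS Q 𝔥 hF.subalgebra hF.scalarProduct : EReal) := by
    intro 𝔨 hlt hk
    refine iSup₂_le fun h hh => ?_
    obtain ⟨f', J', K', μ', hF', hS⟩ := hframe 𝔨 hlt hk h hh
    rw [← hS, hF.hatS_eq]
    exact EReal.coe_le_coe_iff.2 (hmaxF _ _ _ _ hF')
  have hge : (hatS Q 𝔥 hF.subalgebra hF.scalarProduct : EReal) ≤ sigma ρ Q 𝔥 T hF.subalgebra :=
    le_iSup₂_of_le hF.scalarProduct hmem le_rfl
  exact ⟨hF.subalgebra,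
    { lt := hF.lt_subalgebra
      ne_top := hF.subalgebra_ne_top
      attained := ⟨_, hmem, hge.antisymm (hle _ hF.lt_subalgebra hF.subalgebra_ne_top)⟩
      sigma_le := fun 𝔰 h𝔰 hs => (hle 𝔰 (hs.lt_of_ne fun h => hmax (h ▸ h𝔰)) h𝔰.1).trans hge }⟩

end Existence

end HomSpace

end

/-- Let `G` be a compact connected Lie group, `H` a closed connected Lie subgroup with
`dim G / H ≥ 3`, `Q` an `Ad(G)`-invariant scalar product on the Lie algebra of `G` (these are the
scalar products induced by bi-invariant metrics) and `T` an `Ad(H)`-invariant scalar product on `𝔪`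
(these are the `G`-invariant metrics on `G / H`). -/
theorem theorem3p8
    {E : Type*} [NormedAddCommGroup E] [NormedSpace ℝ E] [FiniteDimensional ℝ E] [CompleteSpace E]
    {G : Type*} [TopologicalSpace G] [ChartedSpace E G] [Group G] [LieGroup 𝓘(ℝ, E) ∞ G]
    [T2Space G] [CompactSpace G] [ConnectedSpace G]
    {F : Type*} [NormedAddCommGroup F] [NormedSpace ℝ F] [FiniteDimensional ℝ F]
    (H : Subgroup G) (hclosed : IsClosed (H : Set G)) (hconn : IsConnected (H : Set G))
    [ChartedSpace F H] [LieGroup 𝓘(ℝ, F) ∞ H]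
    (hemb : Manifold.IsSmoothEmbedding 𝓘(ℝ, F) 𝓘(ℝ, E) ∞ (Subtype.val : H → G))
    (hdim : Module.finrank ℝ F + 3 ≤ Module.finrank ℝ E)
    (Q : HomSpace.ScalarProduct (GroupLieAlgebra 𝓘(ℝ, E) G))
    (hQ : ∀ (x : G) (u v : GroupLieAlgebra 𝓘(ℝ, E) G),
      Q.form (HomSpace.Ad E x u) (HomSpace.Ad E x v) = Q.form u v)
    (𝔥 : LieSubalgebra ℝ (GroupLieAlgebra 𝓘(ℝ, E) G))
    (h𝔥 : HomSpace.IsLieAlgebraOf (F := F) H 𝔥)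
    (T : HomSpace.ScalarProduct (HomSpace.mSpace Q 𝔥))
    (hT : HomSpace.InvariantForm (fun x : H => HomSpace.Ad E (x : G)) T)
    (hyp : HomSpace.InequivalenceHypothesis (fun x : H => HomSpace.Ad E (x : G)) Q 𝔥)
    (hmax : ¬ IsCoatom 𝔥) :
    ∃ 𝔨 : LieSubalgebra ℝ (GroupLieAlgebra 𝓘(ℝ, E) G),
      HomSpace.IsApical (fun x : H => HomSpace.Ad E (x : G)) Q 𝔥 T 𝔨 := by

  have hι : MDifferentiableAt 𝓘(ℝ, F) 𝓘(ℝ, E) (Subtype.val : H → G) 1 :=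
    hemb.contMDiff.mdifferentiable (by simp) 1
  refine HomSpace.exists_isApical (fun x u v => hQ x u v) (HomSpace.form_lie_left Q hQ)
    (fun W hW ξ hξ w hw => HomSpace.lie_mem_of_invariantSubspace H hι h𝔥 hW hξ hw)
    (fun 𝔰 hs => HomSpace.invariantSubspace_of_le H hconn hι Q hQ h𝔥 hs) ?_ hmax
  rintro rfl
  have h1 : LinearMap.range (HomSpace.inclusionDeriv E F H) = ⊤ := h𝔥.symm
  have h2 := LinearMap.finrank_range_le (HomSpace.inclusionDeriv E F H)
  rw [h1, finrank_top] at h2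
  have h3 : Module.finrank ℝ E ≤ Module.finrank ℝ F := h2
  omega
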